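/- Let $K$ be a field, let $d\ge 1$ and $n\ge 0$ be integers, and let $X=(x_{i,j})$ be the $(d+1)\times n$ matrix of indeterminates over $K$, with polynomial ring $S=K[x_{i,j}]$. All Gröbner bases are taken with respect to the lexicographic order induced by $x_{1,1}>\dots>x_{1,n}>x_{2,1}>\dots>x_{2,n}>\dots>x_{d+1,1}>\dots>x_{d+1,n}$. A Gröbner basis is *reduced* if all its elements have leading coefficient $1$ and no monomial occurring in one element is divisible by the leading monomial of another element. For $j_1<\dots<j_{d+1}$ in $[n]=\{1,\dots,n\}$ let $\det(j_1,\dots,j_{d+1})$ be the minor of $X$ on the columns $j_1,\dots,j_{d+1}$, and let $I_{d+1}(X)\subseteq S$ be the ideal generated by all $(d+1)$-minors of $X$. Let $\Delta$ be a pure $d$-dimensional simplicial complex on $[n]$ (every vertex is in $[n]$; elements of $[n]$ that are not vertices are allowed), with set of facets $\mathcal F(\Delta)$. Put $$\mathcal B=\{\det(i_1,\dots,i_{d+1}) : i_1<\dots<i_{d+1},\ \{i_1,\dots,i_{d+1}\}\in\mathcal F(\Delta)\},\qquad J_\Delta=\langle\mathcal B\rangle\subseteq S.$$ With respect to the given labelling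 of the vertices by $[n]$, $\Delta$ is called - *closed* if, for all distinct facets $F=\{i_1<\dots<i_{d+1}\}$ and $G=\{j_1<\dots<j_{d+1}\}$ with $i_k=j_k$ for some $k$, the complex $\Delta$ contains the full $d$-skeleton of the simplex on $F\cup G$; - *unit interval* if, for every facet $\{i_1<\dots<i_{d+1}\}$ and all integers $i_1\le j_1<\dots<j_{d+1}\le i_{d+1}$, the set $\{j_1,\dots,j_{d+1}\}$ is a facet; - *poor closed* if, for all distinct facets $F=\{i_1<\dots<i_{d+1}\}$ and $G=\{j_1<\dots<j_{d+1}\}$ with $i_k=j_k$ for some $k$, some facet other than $F$ and $G$ is contained in $F\cup G$. Then: 1. The set of all $(d+1)$-minors of $X$ is a reduced Gröbner basis of $I_{d+1}(X)$. 2. If $\Delta$ is closed, then $\mathcal B$ is a reduced Gröbner basis of $J_\Delta$. 3. If $\Delta$ is unit interval, then $\mathcal B$ is a reduced Gröbner basis of $J_\Delta$. 4. If $\mathcal B$ is a Gröbner basis of $J_\Delta$, then $\Delta$ is poor closed. 5. Let $G$ be a simple graph on $[n]$, and let $J_G\subseteq K[x_{1,1},\dots,x_{1,n},x_{2,1},\dots,x_{2,n}]$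 be the ideal generated by the $2$-minors $\det(i,j)=x_{1,i}x_{2,j}-x_{1,j}x_{2,i}$ with $i<j$ and $\{i,j\}\in E(G)$. Call $G$ closed, with respect to the given labelling, if $\{i,j\},\{i,k\}\in E(G)$ with $i<j<k$ implies $\{j,k\}\in E(G)$, and $\{i,j\},\{k,j\}\in E(G)$ with $i<k<j$ implies $\{i,k\}\in E(G)$. Then $G$ is closed if and only if $\{\det(i,j) : i<j,\ \{i,j\}\in E(G)\}$ is a reduced Gröbner basis of $J_G$, with respect to the lexicographic order induced by $x_{1,1}>\dots>x_{1,n}>x_{2,1}>\dots>x_{2,n}$. -/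

import Mathlib

noncomputable section

namespace DetFacet

/-! ### Gröbner bases over a field -/

section Groebner

variable {σ : Type*} {K : Type*} [Field K]

/-- `B` is a Gröbner basis of the ideal `I` with respect to the monomial order `m`: a finite subset
of `I` whose leading terms generate the initial ideal of `I`. -/
def IsGroebnerBasis (m : MonomialOrder σ) (B : Set (MvPolynomial σ K))
    (I : Ideal (MvPolynomial σ K)) : Prop :=
  B.Finite ∧ B ⊆ (I : Set (MvPolynomial σ K)) ∧
    Ideal.span (m.leadingTerm '' B) = Ideal.span (m.leadingTerm '' (I : Set (MvPolynomial σ K)))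

/-- A Gröbner basis is reduced if its elements have leading coefficient `1` and no monomial of an
element is divisible by the leading monomial of another element. -/
def IsReducedGroebnerBasis (m : MonomialOrder σ) (B : Set (MvPolynomial σ K))
    (I : Ideal (MvPolynomial σ K)) : Prop :=
  IsGroebnerBasis m B I ∧ (∀ f ∈ B, m.leadingCoeff f = 1) ∧
    ∀ f ∈ B, ∀ g ∈ B, g ≠ f → ∀ c ∈ f.support, ¬ m.degree g ≤ c

end Groebner

/-! ### The generic matrix, its minors, and the lexicographic order -/

/-- The polynomial ring `K[x_{i,j}]` in the entries of an `m × n` matrix. The indices carry the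
lexicographic (row by row) order, which serves only to order the variables. -/
abbrev PolyRing (K : Type*) [Field K] (m n : ℕ) : Type _ := MvPolynomial (Fin m ×ₗ Fin n) K

/-- The generic matrix `X = (x_{i,j})`. -/
def genericMatrix (K : Type*) [Field K] (m n : ℕ) : Matrix (Fin m) (Fin n) (PolyRing K m n) :=
  Matrix.of fun i j => MvPolynomial.X (toLex (i, j))

/-- The lexicographic monomial order induced by
`x_{1,1} > ⋯ > x_{1,n} > x_{2,1} > ⋯ > x_{2,n} > ⋯ > x_{m,n}`
(in `MonomialOrder.lex` smaller indices are larger variables). -/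
def lexOrder (m n : ℕ) : MonomialOrder (Fin m ×ₗ Fin n) := MonomialOrder.lex

/-- The set of `r`-minors of a matrix (rows and columns taken in increasing order). -/
def minors {R : Type*} [CommRing R] {m n : ℕ} (M : Matrix (Fin m) (Fin n) R) (r : ℕ) : Set R :=
  {p | ∃ (i : Fin r ↪o Fin m) (j : Fin r ↪o Fin n), p = (M.submatrix i j).det}

/-- The determinantal ideal `I_r(M)`. -/
def determinantalIdeal {R : Type*} [CommRing R] {m n : ℕ} (M : Matrix (Fin m) (Fin n) R) (r : ℕ) :
    Ideal R :=
  Ideal.span (minors M r)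

/-- `det(j_1, …, j_m)`: the maximal minor of the generic matrix on the columns `j_1, …, j_m`. -/
def columnDet (K : Type*) [Field K] {m n : ℕ} (j : Fin m → Fin n) : PolyRing K m n :=
  ((genericMatrix K m n).submatrix id j).det

/-! ### Simplicial complexes on `[n]` -/

section Complexes

variable {n : ℕ}

/-- The facets: the faces that are maximal under inclusion. -/
def facets {V : Type*} (Δ : PreAbstractSimplicialComplex V) : Set (Finset V) :=
  {F | F ∈ Δ.faces ∧ ∀ H ∈ Δ.faces, F ⊆ H → F = H}

/-- `Δ` is pure of dimension `d`: it has a face, and all its facets have `d + 1` vertices. -/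
def IsPureOfDim {V : Type*} (Δ : PreAbstractSimplicialComplex V) (d : ℕ) : Prop :=
  Δ.faces.Nonempty ∧ ∀ F ∈ facets Δ, F.card = d + 1

/-- The set `{i_1, …, i_r}` for `i_1 < ⋯ < i_r`. -/
def vertexSet {r : ℕ} (i : Fin r ↪o Fin n) : Finset (Fin n) := Finset.univ.map i.toEmbedding

/-- `Δ` is closed with respect to the given labelling `[n]`: if two distinct facets
`i_1 < ⋯ < i_{d+1}` and `j_1 < ⋯ < j_{d+1}` satisfy `i_k = j_k` for some `k`, then `Δ` contains the
full `d`-skeleton of the simplex on their union. -/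
def IsClosedComplex (Δ : PreAbstractSimplicialComplex (Fin n)) (d : ℕ) : Prop :=
  ∀ i j : Fin (d + 1) ↪o Fin n, vertexSet i ∈ facets Δ → vertexSet j ∈ facets Δ → i ≠ j →
    (∃ k, i k = j k) →
      ∀ H ⊆ vertexSet i ∪ vertexSet j, H.Nonempty → H.card ≤ d + 1 → H ∈ Δ.faces

/-- `Δ` is unit interval with respect to the given labelling `[n]`: if `i_1 < ⋯ < i_{d+1}` is a
facet, so is every `j_1 < ⋯ < j_{d+1}` with `i_1 ≤ j_1` and `j_{d+1} ≤ i_{d+1}`. -/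
def IsUnitIntervalComplex (Δ : PreAbstractSimplicialComplex (Fin n)) (d : ℕ) : Prop :=
  ∀ i j : Fin (d + 1) ↪o Fin n, vertexSet i ∈ facets Δ →
    i 0 ≤ j 0 → j (Fin.last d) ≤ i (Fin.last d) → vertexSet j ∈ facets Δ

/-- `Δ` is poor closed with respect to the given labelling `[n]`: if two distinct facets
`i_1 < ⋯ < i_{d+1}` and `j_1 < ⋯ < j_{d+1}` satisfy `i_k = j_k` for some `k`, then some facet other
than these two is contained in their union. -/
def IsPoorClosedComplex (Δ : PreAbstractSimplicialComplex (Fin n)) (d : ℕ) : Prop :=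
  ∀ i j : Fin (d + 1) ↪o Fin n, vertexSet i ∈ facets Δ → vertexSet j ∈ facets Δ → i ≠ j →
    (∃ k, i k = j k) →
      ∃ H ∈ facets Δ, H ⊆ vertexSet i ∪ vertexSet j ∧ H ≠ vertexSet i ∧ H ≠ vertexSet j

/-- The facet minors `det(i_1, …, i_{d+1})`, `{i_1 < ⋯ < i_{d+1}}` a facet of `Δ`. -/
def facetMinors (K : Type*) [Field K] (Δ : PreAbstractSimplicialComplex (Fin n)) (d : ℕ) :
    Set (PolyRing K (d + 1) n) :=
  {p | ∃ i : Fin (d + 1) ↪o Fin n, vertexSet i ∈ facets Δ ∧ p = columnDet K i}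

/-- The determinantal facet ideal `J_Δ`. -/
def facetIdeal (K : Type*) [Field K] (Δ : PreAbstractSimplicialComplex (Fin n)) (d : ℕ) :
    Ideal (PolyRing K (d + 1) n) :=
  Ideal.span (facetMinors K Δ d)

end Complexes

/-! ### Graphs on `[n]` -/

section Graphs

variable {n : ℕ}

/-- `G` is closed with respect to the given labelling `[n]`. -/
def IsClosedGraph (G : SimpleGraph (Fin n)) : Prop :=
  (∀ i j k : Fin n, i < j → j < k → G.Adj i j → G.Adj i k → G.Adj j k) ∧
    ∀ i k j : Fin n, i < k → k < j → G.Adj i j → G.Adj k j → G.Adj i k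

/-- The edge minors `det(i, j)`, `{i < j}` an edge of `G`. -/
def edgeMinors (K : Type*) [Field K] (G : SimpleGraph (Fin n)) : Set (PolyRing K 2 n) :=
  {p | ∃ i j : Fin n, i < j ∧ G.Adj i j ∧ p = columnDet K ![i, j]}

/-- The binomial edge ideal `J_G`. -/
def binomialEdgeIdeal (K : Type*) [Field K] (G : SimpleGraph (Fin n)) : Ideal (PolyRing K 2 n) :=
  Ideal.span (edgeMinors K G)

end Graphs

end DetFacet

end

/-!
The determinants on column sets `i` are monic with leading exponent `rowMonomial i`, the diagonal
(`degree_columnDet`). All monomials of such a determinant determine its column set, so a Gröbner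
basis of maximal minors is automatically reduced (`IsGroebnerBasis.isReduced`).

*Sufficiency.* The complete family of column sets, the facets of closed and of unit interval
complexes, and the edges of closed graphs are all exchange-closed (`IsExchangeClosed`), and the
minors of every exchange-closed family form a Gröbner basis
(`IsExchangeClosed.isReducedGroebnerBasis`). By Buchberger's criterion, in the form
`exists_degree_le_of_syzygyLifts`, it is enough to lift the syzygies of pairs of leading monomials.
Two column sets without a common position have coprime leading monomials. Column sets `i ≠ j` that
share a position are joined by a path in which one entry changes at a time, every entry coming from
`i` or `j`: one changes the differing position closest to the shared one, in whichever of the two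
sets keeps its entries between its first and last column (`exists_strictMono_update`). All leading
monomials on the path divide the least common multiple of those of `i` and `j`, so only pairs that
differ in a single position `k` remain. Such a pair consists of `U` without `U k` and `U` without
`U (k + 1)` for some `U 0 < ⋯ < U (d + 1)`; expanding the determinant with columns `U` in which row
`k` occurs twice gives the relation `∑ l, ± x_{k, U l} * det (U without U l) = 0`, whose terms other
than `l = k, k + 1` have smaller leading monomials (`termExponent_lt`).

*Necessity.* If a Gröbner basis of minors contains `det i` and `det j` with `i k₀ = j k₀` but no
third minor on their columns, reducing their S-polynomial gives a relation
`A * det i = B * det j` in which `B` has a monomial free of the variables of row `k₀`. Setting to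
zero all variables of row `k₀` but that of a column of `j` outside `i` makes the left side vanish
and not the right one (`IsGroebnerBasis.exists_mem_ne`). For graphs the third edge on the vertices
of two edges with a shared position is the one that closedness asks for.
-/

noncomputable section

namespace DetFacet

open MvPolynomial
open scoped MonomialOrder

/-! ### Buchberger's criterion for families of monic polynomials -/

section Criterion

variable {σ ι K : Type*} [Field K] {m : MonomialOrder σ}

variable (m) in
/-- The `K`-span of the products `x ^ t * f i` whose leading exponent `t + deg (f i)` lies in `s`
(exponents being identified with elements of `m.syn`). -/
def multiples (f : ι → MvPolynomial σ K) (s : Set m.syn) : Submodule K (MvPolynomial σ K) :=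
  Submodule.span K {p | ∃ (t : σ →₀ ℕ) (i : ι), m.toSyn (t + m.degree (f i)) ∈ s ∧
    p = monomial t 1 * f i}

variable (m) in
/-- The syzygy of the leading terms of the monic polynomials `f i` and `f j` in degree `u` (a common
multiple of both leading monomials) lifts: `x ^ (u - deg (f i)) * f i - x ^ (u - deg (f j)) * f j`
is a combination of multiples of the family with leading exponents below `u`. -/
def SyzygyLifts (f : ι → MvPolynomial σ K) (u : σ →₀ ℕ) (i j : ι) : Prop :=
  monomial (u - m.degree (f i)) 1 * f i - monomial (u - m.degree (f j)) 1 * f j ∈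
    multiples m f (Set.Iio (m.toSyn u))

variable {f : ι → MvPolynomial σ K}

lemma multiples_mono {s t : Set m.syn} (h : s ⊆ t) : multiples m f s ≤ multiples m f t :=
  Submodule.span_mono fun _ ⟨a, i, ha, hp⟩ => ⟨a, i, h ha, hp⟩

lemma monomial_mul_mem_multiples {s : Set m.syn} {t : σ →₀ ℕ} {i : ι} (c : K)
    (h : m.toSyn (t + m.degree (f i)) ∈ s) : monomial t c * f i ∈ multiples m f s := by
  have : monomial t c * f i = c • (monomial t 1 * f i) := by
    rw [← smul_mul_assoc, smul_monomial, smul_eq_mul, mul_one]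
  rw [this]
  exact Submodule.smul_mem _ _ (Submodule.subset_span ⟨t, i, h, rfl⟩)

lemma mul_mem_multiples {s : Set m.syn} {h : MvPolynomial σ K} {i : ι}
    (hs : ∀ t ∈ h.support, m.toSyn (t + m.degree (f i)) ∈ s) : h * f i ∈ multiples m f s := by
  rw [h.as_sum, Finset.sum_mul]
  exact Submodule.sum_mem _ fun t ht => monomial_mul_mem_multiples _ (hs t ht)

lemma lt_of_mem_support_of_mem_multiples {u : σ →₀ ℕ} {p : MvPolynomial σ K}
    (hp : p ∈ multiples m f (Set.Iio (m.toSyn u))) : ∀ t ∈ p.support, t ≺[m] u := by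
  classical
  induction hp using Submodule.span_induction with
  | mem p hp =>
    obtain ⟨t, i, ht, rfl⟩ := hp
    intro s hs
    refine lt_of_le_of_lt (m.le_degree hs) (lt_of_le_of_lt m.degree_mul_le ?_)
    refine lt_of_le_of_lt ?_ ht
    rw [map_add, map_add]
    gcongr
    exact m.degree_monomial_le _
  | zero => simp
  | add p q _ _ hp hq =>
    intro t ht
    rcases Finset.mem_union.1 (support_add ht) with h | h
    exacts [hp t h, hq t h]
  | smul c p _ hp => exact fun t ht => hp t (support_smul ht)

lemma eq_zero_or_exists_mem_multiples_Iic {s : Set m.syn} {p : MvPolynomial σ K}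
    (hp : p ∈ multiples m f s) : p = 0 ∨ ∃ u ∈ s, p ∈ multiples m f (Set.Iic u) := by
  induction hp using Submodule.span_induction with
  | mem p hp =>
    obtain ⟨t, i, ht, rfl⟩ := hp
    exact Or.inr ⟨_, ht, monomial_mul_mem_multiples _ (Set.mem_Iic.2 le_rfl)⟩
  | zero => exact Or.inl rfl
  | add p q _ _ hp hq =>
    rcases hp with rfl | ⟨u, hu, hp⟩
    · simpa using hq
    rcases hq with rfl | ⟨v, hv, hq⟩
    · exact Or.inr ⟨u, hu, by simpa using hp⟩
    rcases le_total u v with h | h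
    · exact Or.inr ⟨v, hv, add_mem (multiples_mono (Set.Iic_subset_Iic.2 h) hp) hq⟩
    · exact Or.inr ⟨u, hu, add_mem hp (multiples_mono (Set.Iic_subset_Iic.2 h) hq)⟩
  | smul c p _ hp =>
    rcases hp with rfl | ⟨u, hu, hp⟩
    · simp
    · exact Or.inr ⟨u, hu, Submodule.smul_mem _ _ hp⟩

/-- If all syzygies in degree `u` lift, then up to multiples with smaller leading exponent only one
multiple with leading exponent `u` is needed. -/
lemma mem_multiples_Iio_or_exists_sub_mem {u : σ →₀ ℕ}
    (H : ∀ i j, m.degree (f i) ≤ u → m.degree (f j) ≤ u → SyzygyLifts m f u i j)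
    {p : MvPolynomial σ K} (hp : p ∈ multiples m f (Set.Iic (m.toSyn u))) :
    p ∈ multiples m f (Set.Iio (m.toSyn u)) ∨ ∃ (c : K) (i : ι), m.degree (f i) ≤ u ∧
      p - c • (monomial (u - m.degree (f i)) 1 * f i) ∈ multiples m f (Set.Iio (m.toSyn u)) := by
  induction hp using Submodule.span_induction with
  | mem p hp =>
    obtain ⟨t, i, ht, rfl⟩ := hp
    rcases lt_or_eq_of_le (Set.mem_Iic.1 ht) with h | h
    · exact Or.inl (monomial_mul_mem_multiples _ h)
    · have hu : t + m.degree (f i) = u := m.toSyn.injective h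
      refine Or.inr ⟨1, i, hu ▸ le_add_self, ?_⟩
      rw [← hu]
      simp
  | zero => exact Or.inl (zero_mem _)
  | add p q _ _ hp hq =>
    rcases hp with hp | ⟨c, i, hi, hp⟩
    · rcases hq with hq | ⟨c, j, hj, hq⟩
      · exact Or.inl (add_mem hp hq)
      · exact Or.inr ⟨c, j, hj, by rw [add_sub_assoc]; exact add_mem hp hq⟩
    · rcases hq with hq | ⟨c', j, hj, hq⟩
      · exact Or.inr ⟨c, i, hi, by rw [add_sub_right_comm]; exact add_mem hp hq⟩
      · refine Or.inr ⟨c + c', i, hi, ?_⟩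
        have := add_mem (add_mem hp hq) (Submodule.smul_mem _ c' (H j i hj hi))
        convert this using 1
        module
  | smul a p _ hp =>
    rcases hp with hp | ⟨c, i, hi, hp⟩
    · exact Or.inl (Submodule.smul_mem _ _ hp)
    · refine Or.inr ⟨a * c, i, hi, ?_⟩
      rw [mul_smul, ← smul_sub]
      exact Submodule.smul_mem _ _ hp

/-- **Buchberger's criterion.** If all syzygies between leading terms of a family of monic
polynomials lift, then every nonzero element of the ideal that the family generates has its leading
monomial divisible by that of a member. -/
theorem exists_degree_le_of_syzygyLifts (hf : ∀ i, m.Monic (f i))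
    (H : ∀ u i j, m.degree (f i) ≤ u → m.degree (f j) ≤ u → SyzygyLifts m f u i j)
    {p : MvPolynomial σ K} (hp : p ∈ Ideal.span (Set.range f)) (hp0 : p ≠ 0) :
    ∃ i, m.degree (f i) ≤ m.degree p := by
  classical
  have key : ∀ u : m.syn, ∀ p ∈ multiples m f (Set.Iic u), p ≠ 0 →
      ∃ i, m.degree (f i) ≤ m.degree p := by
    intro u
    induction u using WellFoundedLT.induction with
    | ind u ih =>
    intro p hp hp0
    obtain ⟨w, rfl⟩ := m.toSyn.surjective u
    have below : p ∈ multiples m f (Set.Iio (m.toSyn w)) → ∃ i, m.degree (f i) ≤ m.degree p := by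
      intro h
      rcases eq_zero_or_exists_mem_multiples_Iic h with h | ⟨v, hv, h⟩
      · exact absurd h hp0
      · exact ih v hv p h hp0
    rcases mem_multiples_Iio_or_exists_sub_mem (H w) hp with h | ⟨c, i, hi, h⟩
    · exact below h
    by_cases hc : c = 0
    · exact below (by simpa [hc] using h)
    -- otherwise the coefficient of `p` at `w` is `c ≠ 0`, and `w` is the degree of `p`
    set q := p - c • (monomial (w - m.degree (f i)) 1 * f i) with hq
    have hpq : p = q + c • (monomial (w - m.degree (f i)) 1 * f i) := by simp [hq]
    have hw : w - m.degree (f i) + m.degree (f i) = w := tsub_add_cancel_of_le hi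
    have hqw : coeff w q = 0 := by
      by_contra h0
      exact lt_irrefl _ (lt_of_mem_support_of_mem_multiples h w (mem_support_iff.2 h0))
    have hcoeff : coeff w p = c := by
      have h1 : coeff w (monomial (w - m.degree (f i)) (1 : K) * f i) = 1 := by
        conv_lhs => rw [← hw]
        rw [add_tsub_cancel_right, coeff_monomial_mul, one_mul, (hf i).coeff_degree]
      rw [hpq, coeff_add, hqw, coeff_smul, h1]
      simp
    have hdeg : m.degree p = w := by
      apply m.toSyn.injective
      apply le_antisymm
      · rw [m.degree_le_iff]
        intro t ht
        rw [hpq] at ht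
        rcases Finset.mem_union.1 (support_add ht) with h' | h'
        · exact (lt_of_mem_support_of_mem_multiples h t h').le
        · refine (m.le_degree (support_smul h')).trans (m.degree_mul_le.trans ?_)
          conv_rhs => rw [← hw]
          rw [map_add, map_add]
          gcongr
          exact m.degree_monomial_le _
      · exact m.le_degree (mem_support_iff.2 (hcoeff ▸ hc))
    exact ⟨i, hdeg ▸ hi⟩
  have huniv : p ∈ multiples m f Set.univ := by
    obtain ⟨c, rfl⟩ := (Finsupp.mem_ideal_span_range_iff_exists_finsupp).1 hp
    exact Submodule.sum_mem _ fun i _ => mul_mem_multiples fun _ _ => Set.mem_univ _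
  rcases eq_zero_or_exists_mem_multiples_Iic huniv with h | ⟨u, -, h⟩
  · exact absurd h hp0
  · exact key u p h hp0

lemma SyzygyLifts.refl (u : σ →₀ ℕ) (i : ι) : SyzygyLifts m f u i i := by
  simp [SyzygyLifts]

lemma SyzygyLifts.symm {u : σ →₀ ℕ} {i j : ι} (h : SyzygyLifts m f u i j) :
    SyzygyLifts m f u j i := by
  simpa [SyzygyLifts] using neg_mem h

lemma SyzygyLifts.trans {u : σ →₀ ℕ} {i j k : ι} (h : SyzygyLifts m f u i j)
    (h' : SyzygyLifts m f u j k) : SyzygyLifts m f u i k := by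
  simpa [SyzygyLifts] using add_mem h h'

lemma lt_degree_of_mem_support_sub_monomial {p : MvPolynomial σ K} (hp : m.Monic p) {t : σ →₀ ℕ}
    (ht : t ∈ (p - monomial (m.degree p) 1).support) : t ≺[m] m.degree p := by
  classical
  rw [mem_support_iff, coeff_sub, coeff_monomial] at ht
  have hne : t ≠ m.degree p := by
    rintro rfl
    simp [hp.coeff_degree] at ht
  rw [if_neg (Ne.symm hne), sub_zero] at ht
  exact lt_of_le_of_ne (m.le_degree (mem_support_iff.2 ht)) fun h => hne (m.toSyn.injective h)

lemma lt_of_mem_support_monomial_mul_sub {p : MvPolynomial σ K} (hp : m.Monic p) {w t : σ →₀ ℕ}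
    (ht : t ∈ (monomial w (1 : K) * (p - monomial (m.degree p) 1)).support) :
    t ≺[m] w + m.degree p := by
  classical
  obtain ⟨t₁, h₁, t₂, h₂, rfl⟩ := Finset.mem_add.1 (support_mul _ _ ht)
  rw [Finset.mem_singleton.1 (support_monomial_subset h₁), map_add, map_add]
  gcongr
  exact lt_degree_of_mem_support_sub_monomial hp h₂

/-- Coprime leading monomials: the syzygy lifts to the trivial relation `f j * f i = f i * f j`. -/
lemma SyzygyLifts.of_disjoint (hf : ∀ i, m.Monic (f i)) {u : σ →₀ ℕ} {i j : ι}
    (hi : m.degree (f i) ≤ u) (hj : m.degree (f j) ≤ u)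
    (hij : ∀ v, m.degree (f i) v = 0 ∨ m.degree (f j) v = 0) : SyzygyLifts m f u i j := by
  have hsum : m.degree (f i) + m.degree (f j) ≤ u := by
    intro v
    have h1 := hi v
    have h2 := hj v
    rw [Finsupp.add_apply]
    rcases hij v with h | h <;> omega
  obtain ⟨w, rfl⟩ := exists_add_of_le hsum
  set a := m.degree (f i) with ha
  set b := m.degree (f j) with hb
  have e1 : a + b + w - a = w + b := by
    rw [add_assoc, add_tsub_cancel_left, add_comm]
  have e2 : a + b + w - b = w + a := by
    rw [add_comm a b, add_assoc, add_tsub_cancel_left, add_comm]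
  have key : monomial (w + b) 1 * f i - monomial (w + a) 1 * f j =
      (monomial w 1 * (f i - monomial a 1)) * f j -
        (monomial w 1 * (f j - monomial b 1)) * f i := by
    rw [show monomial (w + b) (1 : K) = monomial w 1 * monomial b 1 by simp [monomial_mul],
      show monomial (w + a) (1 : K) = monomial w 1 * monomial a 1 by simp [monomial_mul]]
    ring
  rw [SyzygyLifts, ← ha, ← hb, e1, e2, key]
  refine sub_mem (mul_mem_multiples fun t ht => ?_) (mul_mem_multiples fun t ht => ?_)
  · have := lt_of_mem_support_monomial_mul_sub (hf i) ht
    rw [Set.mem_Iio, show a + b + w = (w + a) + b by abel, map_add _ t, map_add _ (w + a)]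
    gcongr
  · have := lt_of_mem_support_monomial_mul_sub (hf j) ht
    rw [Set.mem_Iio, show a + b + w = (w + b) + a by abel, map_add _ t, map_add _ (w + b)]
    gcongr

lemma isGroebnerBasis_span {B : Set (MvPolynomial σ K)} (hfin : B.Finite)
    (hB : ∀ b ∈ B, m.Monic b)
    (H : ∀ p ∈ Ideal.span B, p ≠ 0 → ∃ b ∈ B, m.degree b ≤ m.degree p) :
    IsGroebnerBasis m B (Ideal.span B) := by
  refine ⟨hfin, Ideal.subset_span, le_antisymm
    (Ideal.span_mono (Set.image_mono Ideal.subset_span)) (Ideal.span_le.2 ?_)⟩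
  rintro _ ⟨p, hp, rfl⟩
  by_cases hp0 : p = 0
  · simp [hp0]
  obtain ⟨b, hb, hle⟩ := H p hp hp0
  have : m.leadingTerm p =
      monomial (m.degree p - m.degree b) (m.leadingCoeff p) * m.leadingTerm b := by
    rw [MonomialOrder.leadingTerm, MonomialOrder.leadingTerm, monomial_mul,
      tsub_add_cancel_of_le hle, (hB b hb).leadingCoeff_eq_one, mul_one]
  rw [SetLike.mem_coe, this]
  exact Ideal.mul_mem_left _ _ (Ideal.subset_span ⟨b, hb, rfl⟩)

lemma IsGroebnerBasis.exists_degree_le {B : Set (MvPolynomial σ K)}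
    {I : Ideal (MvPolynomial σ K)} (h : IsGroebnerBasis m B I) (hB : ∀ b ∈ B, m.Monic b)
    {p : MvPolynomial σ K} (hp : p ∈ I) (hp0 : p ≠ 0) : ∃ b ∈ B, m.degree b ≤ m.degree p := by
  classical
  have h1 : m.leadingTerm p ∈ Ideal.span (m.leadingTerm '' B) := by
    rw [h.2.2]
    exact Ideal.subset_span ⟨p, hp, rfl⟩
  have h2 : m.leadingTerm '' B = (fun s => monomial s (1 : K)) '' (m.degree '' B) := by
    rw [Set.image_image]
    refine Set.image_congr fun b hb => ?_
    rw [MonomialOrder.leadingTerm, (hB b hb).leadingCoeff_eq_one]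
  rw [h2, mem_ideal_span_monomial_image] at h1
  obtain ⟨_, ⟨b, hb, rfl⟩, hle⟩ := h1 (m.degree p) (by
    rw [m.support_leadingTerm' hp0]
    exact Finset.mem_singleton_self _)
  exact ⟨b, hb, hle⟩

end Criterion

/-! ### Leading terms of maximal minors -/

section Minors

variable {m n : ℕ}

/-- The exponent of the monomial `∏ k, x_{k, τ k}`, which has one variable from every row. -/
def rowMonomial (τ : Fin m → Fin n) : Fin m ×ₗ Fin n →₀ ℕ :=
  ∑ k, Finsupp.single (toLex (k, τ k)) 1

lemma rowMonomial_apply (τ : Fin m → Fin n) (k : Fin m) (c : Fin n) :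
    rowMonomial τ (toLex (k, c)) = if τ k = c then 1 else 0 := by
  classical
  rw [rowMonomial, Finsupp.finsetSum_apply, Finset.sum_eq_single k]
  · simp [Finsupp.single_apply]
  · intro b _ hb
    simp [hb]
  · simp

lemma rowMonomial_injective : Function.Injective (rowMonomial (m := m) (n := n)) := by
  intro τ τ' h
  funext k
  have := DFunLike.congr_fun h (toLex (k, τ k))
  rw [rowMonomial_apply, rowMonomial_apply, if_pos rfl] at this
  by_contra hne
  simp [Ne.symm hne] at this

lemma rowMonomial_le_iff {τ : Fin m → Fin n} {u : Fin m ×ₗ Fin n →₀ ℕ} :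
    rowMonomial τ ≤ u ↔ ∀ k, 1 ≤ u (toLex (k, τ k)) := by
  constructor
  · intro h k
    have := h (toLex (k, τ k))
    rwa [rowMonomial_apply, if_pos rfl] at this
  · rintro h ⟨k, c⟩
    change rowMonomial τ (toLex (k, c)) ≤ u (toLex (k, c))
    rw [rowMonomial_apply]
    split_ifs with hk
    · exact hk ▸ h k
    · exact Nat.zero_le _

lemma lexOrder_lt {a b : Fin m ×ₗ Fin n →₀ ℕ} (k : Fin m) (c : Fin n)
    (hrow : ∀ k' < k, ∀ c', a (toLex (k', c')) = b (toLex (k', c')))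
    (hcol : ∀ c' < c, a (toLex (k, c')) = b (toLex (k, c')))
    (hlt : a (toLex (k, c)) < b (toLex (k, c))) : a ≺[lexOrder m n] b := by
  change toLex a < toLex b
  refine Finsupp.Lex.lt_iff.2 ⟨toLex (k, c), ?_, hlt⟩
  rintro ⟨k', c'⟩ h
  rcases Prod.Lex.toLex_lt_toLex.1 (show toLex (k', c') < toLex (k, c) from h) with h | ⟨h, h'⟩
  · exact hrow k' h c'
  · obtain rfl : k' = k := h
    exact hcol c' h'

lemma rowMonomial_lt {τ τ' : Fin m → Fin n} (k : Fin m) (heq : ∀ r < k, τ r = τ' r)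
    (hk : τ' k < τ k) : rowMonomial τ ≺[lexOrder m n] rowMonomial τ' := by
  refine lexOrder_lt k (τ' k) (fun r hr c => ?_) (fun c hc => ?_) ?_
  · rw [rowMonomial_apply, rowMonomial_apply, heq r hr]
  · rw [rowMonomial_apply, rowMonomial_apply, if_neg (hc.trans hk).ne', if_neg hc.ne']
  · rw [rowMonomial_apply, rowMonomial_apply, if_neg hk.ne', if_pos rfl]
    exact Nat.zero_lt_one

variable (K : Type*) [Field K]

lemma prod_X_eq_monomial (τ : Fin m → Fin n) :
    ∏ k, (X (toLex (k, τ k)) : PolyRing K m n) = monomial (rowMonomial τ) 1 := by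
  rw [rowMonomial, monomial_sum_one]
  rfl

lemma columnDet_eq_sum (j : Fin m → Fin n) :
    columnDet K j = ∑ s : Equiv.Perm (Fin m),
      Equiv.Perm.sign s • (monomial (rowMonomial (j ∘ s)) 1 : PolyRing K m n) := by
  rw [columnDet, ← Matrix.det_transpose, Matrix.det_apply]
  refine Finset.sum_congr rfl fun s _ => ?_
  rw [← prod_X_eq_monomial]
  rfl

variable {K}

lemma exists_perm_of_mem_support_columnDet {j : Fin m → Fin n} {t : Fin m ×ₗ Fin n →₀ ℕ}
    (ht : t ∈ (columnDet K j).support) : ∃ s : Equiv.Perm (Fin m), t = rowMonomial (j ∘ s) := by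
  classical
  by_contra! h
  refine mem_support_iff.1 ht ?_
  rw [columnDet_eq_sum, coeff_sum]
  refine Finset.sum_eq_zero fun s _ => ?_
  rw [Units.smul_def, zsmul_eq_mul, ← map_intCast (C : K →+* PolyRing K m n), coeff_C_mul,
    coeff_monomial, if_neg (h s).symm, mul_zero]

lemma coeff_rowMonomial_comp_perm_columnDet {j : Fin m → Fin n} (hj : Function.Injective j)
    (s : Equiv.Perm (Fin m)) :
    coeff (rowMonomial (j ∘ s)) (columnDet K j) = ((Equiv.Perm.sign s : ℤ) : K) := by
  classical
  rw [columnDet_eq_sum, coeff_sum, Finset.sum_eq_single s]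
  · rw [Units.smul_def, zsmul_eq_mul, ← map_intCast (C : K →+* PolyRing K m n), coeff_C_mul,
      coeff_monomial, if_pos rfl, mul_one]
  · intro s' _ hs
    have : rowMonomial (j ∘ s') ≠ rowMonomial (j ∘ s) := fun h =>
      hs (Equiv.ext fun k => hj (congrFun (rowMonomial_injective h) k))
    rw [Units.smul_def, zsmul_eq_mul, ← map_intCast (C : K →+* PolyRing K m n), coeff_C_mul,
      coeff_monomial, if_neg this, mul_zero]
  · simp

lemma coeff_rowMonomial_columnDet {j : Fin m → Fin n} (hj : Function.Injective j) :
    coeff (rowMonomial j) (columnDet K j) = 1 := by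
  simpa using coeff_rowMonomial_comp_perm_columnDet (K := K) hj 1

lemma rowMonomial_comp_perm_le {j : Fin m → Fin n} (hj : StrictMono j)
    (s : Equiv.Perm (Fin m)) : rowMonomial (j ∘ s) ≼[lexOrder m n] rowMonomial j := by
  classical
  by_cases hs : s = 1
  · simp [hs]
  have hne : (Finset.univ.filter fun k => s k ≠ k).Nonempty := by
    by_contra h
    refine hs (Equiv.ext fun k => ?_)
    by_contra hk
    exact h ⟨k, by simpa using hk⟩
  -- the first row in which the monomials differ
  set k := (Finset.univ.filter fun k => s k ≠ k).min' hne with hk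
  have hk1 : s k ≠ k := by
    have := Finset.min'_mem _ hne
    rw [← hk] at this
    simpa using this
  have hk2 : ∀ r < k, s r = r := by
    intro r hr
    by_contra h
    exact absurd (Finset.min'_le _ r (by simpa using h)) (not_le.2 (hk ▸ hr))
  refine (rowMonomial_lt (τ := j ∘ s) k (fun r hr => by simp [hk2 r hr]) (hj ?_)).le
  refine lt_of_le_of_ne (not_lt.1 fun h => ?_) (Ne.symm hk1)
  exact hk1 (s.injective (hk2 _ h))

lemma degree_columnDet {j : Fin m → Fin n} (hj : StrictMono j) :
    (lexOrder m n).degree (columnDet K j) = rowMonomial j := by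
  apply (lexOrder m n).toSyn.injective
  apply le_antisymm
  · rw [MonomialOrder.degree_le_iff]
    intro t ht
    obtain ⟨s, rfl⟩ := exists_perm_of_mem_support_columnDet ht
    exact rowMonomial_comp_perm_le hj s
  · apply MonomialOrder.le_degree
    rw [mem_support_iff, coeff_rowMonomial_columnDet hj.injective]
    exact one_ne_zero

lemma monic_columnDet {j : Fin m → Fin n} (hj : StrictMono j) :
    (lexOrder m n).Monic (columnDet K j) := by
  rw [MonomialOrder.Monic, MonomialOrder.leadingCoeff, degree_columnDet hj,
    coeff_rowMonomial_columnDet hj.injective]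

lemma orderEmbedding_eq_of_forall_exists_eq {i j : Fin m ↪o Fin n}
    (h : ∀ k, ∃ l, j k = i l) : j = i := by
  have hsub : Finset.univ.map j.toEmbedding ⊆ Finset.univ.map i.toEmbedding := by
    intro x hx
    obtain ⟨k, -, rfl⟩ := Finset.mem_map.1 hx
    obtain ⟨l, hl⟩ := h k
    exact Finset.mem_map.2 ⟨l, Finset.mem_univ _, hl.symm⟩
  have heq := Finset.eq_of_subset_of_card_le hsub (by simp)
  have : Set.range j = Set.range i := by
    have := congrArg (fun s : Finset (Fin n) => (s : Set (Fin n))) heq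
    simpa using this
  exact OrderEmbedding.range_inj.1 this

/-- The `m`-minors of an `m × n` matrix use different sets of columns, which can be read off from
any of their monomials. Hence the leading monomial of one minor divides no monomial of another. -/
lemma not_degree_columnDet_le {i j : Fin m ↪o Fin n} (hij : j ≠ i) {t : Fin m ×ₗ Fin n →₀ ℕ}
    (ht : t ∈ (columnDet K i).support) : ¬ (lexOrder m n).degree (columnDet K j) ≤ t := by
  intro hle
  obtain ⟨s, rfl⟩ := exists_perm_of_mem_support_columnDet ht
  rw [degree_columnDet j.strictMono, rowMonomial_le_iff] at hle
  refine hij (orderEmbedding_eq_of_forall_exists_eq fun k => ⟨s k, ?_⟩)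
  have := hle k
  rw [rowMonomial_apply] at this
  by_contra h
  rw [if_neg (fun h' => h h'.symm)] at this
  exact absurd this (by norm_num)

/-- A Gröbner basis made of maximal minors is automatically reduced. -/
lemma IsGroebnerBasis.isReduced {𝓕 : Set (Fin m ↪o Fin n)} {I : Ideal (PolyRing K m n)}
    (h : IsGroebnerBasis (lexOrder m n) ((fun i : Fin m ↪o Fin n => columnDet K i) '' 𝓕) I) :
    IsReducedGroebnerBasis (lexOrder m n) ((fun i : Fin m ↪o Fin n => columnDet K i) '' 𝓕) I := by
  refine ⟨h, ?_, ?_⟩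
  · rintro _ ⟨i, -, rfl⟩
    exact monic_columnDet i.strictMono
  · rintro _ ⟨i, -, rfl⟩ _ ⟨j, -, rfl⟩ hne t ht
    refine not_degree_columnDet_le ?_ ht
    rintro rfl
    exact hne rfl

end Minors

/-! ### Exchange-closed families of column sets -/

section Exchange

variable {d n : ℕ}

/-- The column set obtained from `U 0 < ⋯ < U (d + 1)` by leaving out `U l`. -/
def dropColumn (U : Fin (d + 2) ↪o Fin n) (l : Fin (d + 2)) : Fin (d + 1) ↪o Fin n :=
  (Fin.succAboveOrderEmb l).trans U

lemma dropColumn_apply (U : Fin (d + 2) ↪o Fin n) (l : Fin (d + 2)) (k : Fin (d + 1)) :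
    dropColumn U l k = U (l.succAbove k) := rfl

/-- A family of `(d + 1)`-sets of columns is *exchange-closed* if

* for members `i`, `j` that share a position, it contains every column set which agrees in each
  position with `i` or `j` and lies between the first and the last column of `i`;
* whenever it contains two sets that differ in one position only, that is, the sets obtained from
  some `U 0 < ⋯ < U (d + 1)` by leaving out `U (k + 1)` and `U k`, it contains all
  `(d + 1)`-subsets of `U`. -/
structure IsExchangeClosed (𝓕 : Set (Fin (d + 1) ↪o Fin n)) : Prop where
  mem_of_forall_eq_or_eq : ∀ i ∈ 𝓕, ∀ j ∈ 𝓕, (∃ k, i k = j k) → ∀ l : Fin (d + 1) ↪o Fin n,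
    (∀ k, l k = i k ∨ l k = j k) → i 0 ≤ l 0 → l (Fin.last d) ≤ i (Fin.last d) → l ∈ 𝓕
  dropColumn_mem : ∀ (U : Fin (d + 2) ↪o Fin n) (k : Fin (d + 1)),
    dropColumn U k.succ ∈ 𝓕 → dropColumn U k.castSucc ∈ 𝓕 → ∀ l, dropColumn U l ∈ 𝓕

lemma strictMono_update {i : Fin (d + 1) ↪o Fin n} {k : Fin (d + 1)} {c : Fin n}
    (hlt : ∀ r < k, i r < c) (hgt : ∀ r, k < r → c < i r) :
    StrictMono (Function.update i k c) := by
  intro r s hrs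
  rcases eq_or_ne r k with rfl | hr
  · rw [Function.update_self, Function.update_of_ne hrs.ne']
    exact hgt s hrs
  · rw [Function.update_of_ne hr]
    rcases eq_or_ne s k with rfl | hs
    · rw [Function.update_self]
      exact hlt r hrs
    · rw [Function.update_of_ne hs]
      exact i.strictMono hrs

/-- One step of a path between two column sets that share a position: at the differing position
closest to the shared one, one of the two sets can take over the entry of the other, moving its
entry towards the shared column and so staying between its first and its last column. -/
lemma exists_strictMono_update {i j : Fin (d + 1) ↪o Fin n} (hij : i ≠ j) {k₀ : Fin (d + 1)}
    (hk₀ : i k₀ = j k₀) : ∃ k, i k ≠ j k ∧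
      ((StrictMono (Function.update i k (j k)) ∧ i 0 ≤ Function.update i k (j k) 0 ∧
          Function.update i k (j k) (Fin.last d) ≤ i (Fin.last d)) ∨
        (StrictMono (Function.update j k (i k)) ∧ j 0 ≤ Function.update j k (i k) 0 ∧
          Function.update j k (i k) (Fin.last d) ≤ j (Fin.last d))) := by
  classical
  -- raising an entry left of the shared position, if the positions in between are shared
  have raise : ∀ i j : Fin (d + 1) ↪o Fin n, ∀ k < k₀, i k < j k →
      (∀ r, k < r → r ≤ k₀ → i r = j r) →
      StrictMono (Function.update i k (j k)) ∧ i 0 ≤ Function.update i k (j k) 0 ∧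
          Function.update i k (j k) (Fin.last d) ≤ i (Fin.last d) := by
    intro i j k hk hlt heq
    refine ⟨strictMono_update (fun r hr => (i.strictMono hr).trans hlt) fun r hr => ?_, ?_, ?_⟩
    · rcases le_total r k₀ with h | h
      · rw [heq r hr h]
        exact j.strictMono hr
      · refine lt_of_lt_of_le ?_ (i.monotone h)
        rw [heq k₀ hk le_rfl]
        exact j.strictMono hk
    · rcases eq_or_ne 0 k with rfl | h
      · rw [Function.update_self]
        exact hlt.le
      · rw [Function.update_of_ne h]
    · rw [Function.update_of_ne (lt_of_lt_of_le hk (Fin.le_last _)).ne']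
  -- lowering an entry right of the shared position, if the positions in between are shared
  have lower : ∀ i j : Fin (d + 1) ↪o Fin n, ∀ k, k₀ < k → j k < i k →
      (∀ r, k₀ ≤ r → r < k → i r = j r) →
      StrictMono (Function.update i k (j k)) ∧ i 0 ≤ Function.update i k (j k) 0 ∧
          Function.update i k (j k) (Fin.last d) ≤ i (Fin.last d) := by
    intro i j k hk hlt heq
    refine ⟨strictMono_update (fun r hr => ?_) (fun r hr => hlt.trans (i.strictMono hr)), ?_, ?_⟩
    · rcases le_total k₀ r with h | h
      · rw [heq r h hr]
        exact j.strictMono hr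
      · refine lt_of_le_of_lt (i.monotone h) ?_
        rw [heq k₀ le_rfl hk]
        exact j.strictMono hk
    · rw [Function.update_of_ne (lt_of_le_of_lt (Fin.zero_le _) hk).ne]
    · rcases eq_or_ne (Fin.last d) k with rfl | h
      · rw [Function.update_self]
        exact hlt.le
      · rw [Function.update_of_ne h]
  by_cases hL : (Finset.univ.filter fun k => k < k₀ ∧ i k ≠ j k).Nonempty
  · set k := (Finset.univ.filter fun k => k < k₀ ∧ i k ≠ j k).max' hL with hk
    obtain ⟨h1, h2⟩ : k < k₀ ∧ i k ≠ j k := by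
      simpa [← hk] using Finset.max'_mem _ hL
    have h3 : ∀ r, k < r → r ≤ k₀ → i r = j r := by
      intro r hr hr'
      rcases eq_or_lt_of_le hr' with rfl | hr'
      · exact hk₀
      by_contra h
      exact absurd (Finset.le_max' _ r (by simpa using ⟨hr', h⟩)) (not_le.2 (hk ▸ hr))
    refine ⟨k, h2, ?_⟩
    rcases lt_or_gt_of_ne h2 with h | h
    · exact Or.inl (raise i j k h1 h h3)
    · exact Or.inr (raise j i k h1 h fun r hr hr' => (h3 r hr hr').symm)
  · have hLe : ∀ r < k₀, i r = j r := by
      intro r hr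
      by_contra h
      exact hL ⟨r, by simpa using ⟨hr, h⟩⟩
    have hR : (Finset.univ.filter fun k => k₀ < k ∧ i k ≠ j k).Nonempty := by
      by_contra hR
      refine hij (DFunLike.ext _ _ fun r => ?_)
      rcases lt_trichotomy r k₀ with h | rfl | h
      · exact hLe r h
      · exact hk₀
      · by_contra h'
        exact hR ⟨r, by simpa using ⟨h, h'⟩⟩
    set k := (Finset.univ.filter fun k => k₀ < k ∧ i k ≠ j k).min' hR with hk
    obtain ⟨h1, h2⟩ : k₀ < k ∧ i k ≠ j k := by
      simpa [← hk] using Finset.min'_mem _ hR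
    have h3 : ∀ r, k₀ ≤ r → r < k → i r = j r := by
      intro r hr hr'
      rcases eq_or_lt_of_le hr with rfl | hr
      · exact hk₀
      by_contra h
      exact absurd (Finset.min'_le _ r (by simpa using ⟨hr, h⟩)) (not_le.2 (hk ▸ hr'))
    refine ⟨k, h2, ?_⟩
    rcases lt_or_gt_of_ne h2 with h | h
    · exact Or.inr (lower j i k h1 h fun r hr hr' => (h3 r hr hr').symm)
    · exact Or.inl (lower i j k h1 h h3)

/-- Column sets that differ in one position arise from a common set by leaving out consecutive
elements. -/
lemma exists_dropColumn_eq {i j : Fin (d + 1) ↪o Fin n} {k : Fin (d + 1)} (hk : i k < j k)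
    (heq : ∀ r ≠ k, i r = j r) : ∃ U : Fin (d + 2) ↪o Fin n,
      dropColumn U k.succ = i ∧ dropColumn U k.castSucc = j := by
  have hmono : StrictMono fun r : Fin (d + 2) =>
      if h : r.val ≤ k.val then i ⟨r.val, by omega⟩ else j ⟨r.val - 1, by omega⟩ := by
    intro r s hrs
    have hrs' : r.val < s.val := hrs
    dsimp only
    split_ifs with h1 h2 h2
    · exact i.strictMono hrs
    · refine lt_of_le_of_lt (i.monotone (show _ ≤ k from h1)) (hk.trans_le (j.monotone ?_))
      change k.val ≤ s.val - 1
      omega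
    · omega
    · refine j.strictMono ?_
      change r.val - 1 < s.val - 1
      omega
  refine ⟨OrderEmbedding.ofStrictMono _ hmono, ?_, ?_⟩
  · ext1 r
    rw [dropColumn_apply, OrderEmbedding.coe_ofStrictMono]
    rcases le_or_gt r k with h | h
    · rw [Fin.succAbove_of_castSucc_lt _ _ (Fin.castSucc_lt_succ_iff.2 h)]
      exact dif_pos h
    · rw [Fin.succAbove_of_le_castSucc _ _ (Fin.succ_le_castSucc_iff.2 h)]
      have h' : k.val < r.val := h
      rw [heq r h.ne']
      exact dif_neg (show ¬ r.val + 1 ≤ k.val by omega)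
  · ext1 r
    rw [dropColumn_apply, OrderEmbedding.coe_ofStrictMono]
    rcases lt_or_ge r k with h | h
    · rw [Fin.succAbove_of_castSucc_lt _ _ (Fin.castSucc_lt_castSucc_iff.2 h), ← heq r h.ne]
      exact dif_pos h.le
    · rw [Fin.succAbove_of_le_castSucc _ _ (Fin.castSucc_le_castSucc_iff.2 h)]
      have h' : k.val ≤ r.val := h
      exact dif_neg (show ¬ r.val + 1 ≤ k.val by omega)

variable (K : Type*) [Field K]

/-- The determinant of the columns `U` of the generic matrix with row `k` written twice vanishes;
this is its expansion along the extra row. -/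
lemma sum_X_mul_columnDet_dropColumn (U : Fin (d + 2) ↪o Fin n) (k : Fin (d + 1)) :
    ∑ l : Fin (d + 2), (-1) ^ (l : ℕ) * (X (toLex (k, U l)) : PolyRing K (d + 1) n) *
      columnDet K (dropColumn U l) = 0 := by
  have h := Matrix.det_succ_row_zero
    (Matrix.of (Fin.cons (genericMatrix K (d + 1) n k ∘ U)
      fun r => genericMatrix K (d + 1) n r ∘ U) :
        Matrix (Fin (d + 2)) (Fin (d + 2)) (PolyRing K (d + 1) n))
  rw [Matrix.det_zero_of_row_eq (Fin.succ_ne_zero k).symm (by ext; simp)] at h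
  exact h.symm

end Exchange

/-! ### Lifting syzygies between maximal minors -/

section Lifting

variable {d n : ℕ}

/-- The leading exponent of the term `x_{k, U l} * det (U without U l)` in the expansion of the
determinant with row `k` written twice. -/
def termExponent (U : Fin (d + 2) ↪o Fin n) (k : Fin (d + 1)) (l : Fin (d + 2)) :
    Fin (d + 1) ×ₗ Fin n →₀ ℕ :=
  Finsupp.single (toLex (k, U l)) 1 + rowMonomial (dropColumn U l)

lemma termExponent_apply (U : Fin (d + 2) ↪o Fin n) (k r : Fin (d + 1))
    (l : Fin (d + 2)) (c : Fin n) : termExponent U k l (toLex (r, c)) =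
      (if k = r ∧ U l = c then 1 else 0) + if U (l.succAbove r) = c then 1 else 0 := by
  classical
  rw [termExponent, Finsupp.add_apply, rowMonomial_apply, Finsupp.single_apply, dropColumn_apply]
  congr 2
  simp

lemma termExponent_succ (U : Fin (d + 2) ↪o Fin n) (k : Fin (d + 1)) :
    termExponent U k k.succ = termExponent U k k.castSucc := by
  ext ⟨r, c⟩
  change termExponent U k k.succ (toLex (r, c)) = termExponent U k k.castSucc (toLex (r, c))
  rw [termExponent_apply, termExponent_apply]
  rcases lt_trichotomy r k with h | rfl | h
  · rw [Fin.succAbove_of_castSucc_lt k.succ r (Fin.castSucc_lt_succ_iff.2 h.le),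
      Fin.succAbove_of_castSucc_lt k.castSucc r (Fin.castSucc_lt_castSucc_iff.2 h)]
    simp [h.ne']
  · rw [Fin.succAbove_of_castSucc_lt r.succ r (Fin.castSucc_lt_succ_iff.2 le_rfl),
      Fin.succAbove_of_le_castSucc r.castSucc r le_rfl]
    simp [add_comm]
  · rw [Fin.succAbove_of_le_castSucc k.succ r (Fin.succ_le_castSucc_iff.2 h),
      Fin.succAbove_of_le_castSucc k.castSucc r (Fin.castSucc_le_castSucc_iff.2 h.le)]
    simp [h.ne]

/-- In the expansion `∑ l, ± x_{k, U l} * det (U without U l) = 0` the terms `l = k` and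
`l = k + 1` share the leading monomial, and all other terms have smaller leading monomials. -/
lemma termExponent_lt (U : Fin (d + 2) ↪o Fin n) (k : Fin (d + 1))
    {l : Fin (d + 2)} (h₁ : l ≠ k.castSucc) (h₂ : l ≠ k.succ) :
    termExponent U k l ≺[lexOrder (d + 1) n] termExponent U k k.succ := by
  rcases lt_or_gt_of_ne h₁ with hl | hl
  · -- the monomials first differ in row `l`, where the left one has the column after `U l`
    have hlast : l ≠ Fin.last (d + 1) := (lt_of_lt_of_le hl (Fin.le_last _)).ne
    obtain ⟨r, rfl⟩ := Fin.exists_castSucc_eq.2 hlast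
    have hr : r < k := Fin.castSucc_lt_castSucc_iff.1 hl
    have e : k.succ.succAbove r = r.castSucc :=
      Fin.succAbove_of_castSucc_lt _ _ (Fin.castSucc_lt_succ_iff.2 hr.le)
    have e' : r.castSucc.succAbove r = r.succ := Fin.succAbove_of_le_castSucc _ _ le_rfl
    have hlt : U r.castSucc < U r.succ := U.strictMono (Fin.castSucc_lt_succ_iff.2 le_rfl)
    refine lexOrder_lt r (U r.castSucc) (fun r' hr' c => ?_) (fun c hc => ?_) ?_
    · rw [termExponent_apply, termExponent_apply,
        Fin.succAbove_of_castSucc_lt k.succ r' (Fin.castSucc_lt_succ_iff.2 (hr'.trans hr).le),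
        Fin.succAbove_of_castSucc_lt r.castSucc r' (Fin.castSucc_lt_castSucc_iff.2 hr')]
      simp [(hr'.trans hr).ne']
    · rw [termExponent_apply, termExponent_apply, e, e']
      simp [hr.ne', hc.ne', (hc.trans hlt).ne']
    · rw [termExponent_apply, termExponent_apply, e, e']
      simp [hr.ne', hlt.ne']
  · -- the monomials first differ in row `k`, with columns `U k`, `U l` and `U k`, `U (k + 1)`
    have hl : k.succ < l := lt_of_le_of_ne (Fin.castSucc_lt_iff_succ_le.1 hl) h₂.symm
    have hlt : U k.succ < U l := U.strictMono hl
    have e : ∀ r ≤ k, k.succ.succAbove r = r.castSucc := fun r hr =>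
      Fin.succAbove_of_castSucc_lt _ _ (Fin.castSucc_lt_succ_iff.2 hr)
    have e' : ∀ r ≤ k, l.succAbove r = r.castSucc := fun r hr =>
      Fin.succAbove_of_castSucc_lt _ _ ((Fin.castSucc_lt_succ_iff.2 hr).trans hl)
    refine lexOrder_lt k (U k.succ) (fun r hr c => ?_) (fun c hc => ?_) ?_
    · rw [termExponent_apply, termExponent_apply,
        e r hr.le, e' r hr.le]
      simp [hr.ne']
    · rw [termExponent_apply, termExponent_apply,
        e k le_rfl, e' k le_rfl]
      simp [hc.ne', (hc.trans hlt).ne']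
    · rw [termExponent_apply, termExponent_apply,
        e k le_rfl, e' k le_rfl]
      simp [hlt.ne']

variable {K : Type*} [Field K] {𝓕 : Set (Fin (d + 1) ↪o Fin n)}

variable (K 𝓕) in
/-- The maximal minors on the column sets of the family `𝓕`, as an indexed family. -/
def minorFamily : 𝓕 → PolyRing K (d + 1) n := fun i => columnDet K i.1

lemma degree_minorFamily (i : 𝓕) :
    (lexOrder (d + 1) n).degree (minorFamily K 𝓕 i) = rowMonomial i.1 :=
  degree_columnDet i.1.strictMono

lemma range_minorFamily : Set.range (minorFamily K 𝓕) =
    (fun i : Fin (d + 1) ↪o Fin n => columnDet K i) '' 𝓕 := by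
  rw [Set.image_eq_range]
  rfl

lemma syzygyLifts_dropColumn {U : Fin (d + 2) ↪o Fin n} (k : Fin (d + 1))
    (hU : ∀ l, dropColumn U l ∈ 𝓕) {u : Fin (d + 1) ×ₗ Fin n →₀ ℕ}
    (h₁ : rowMonomial (dropColumn U k.succ) ≤ u) (h₂ : rowMonomial (dropColumn U k.castSucc) ≤ u) :
    SyzygyLifts (lexOrder (d + 1) n) (minorFamily K 𝓕) u
      ⟨dropColumn U k.succ, hU _⟩ ⟨dropColumn U k.castSucc, hU _⟩ := by
  classical
  set E := termExponent U k k.succ with hE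
  have hE' : E = termExponent U k k.castSucc := termExponent_succ U k
  have hle : E ≤ u := by
    rintro ⟨r, c⟩
    change E (toLex (r, c)) ≤ u (toLex (r, c))
    have a₁ := h₁ (toLex (r, c))
    have a₂ := h₂ (toLex (r, c))
    have hne : U k.castSucc ≠ U k.succ :=
      (U.strictMono (Fin.castSucc_lt_succ_iff.2 le_rfl)).ne
    by_cases h : toLex (k, U k.succ) = toLex (r, c)
    · have h' : toLex (k, U k.castSucc) ≠ toLex (r, c) := by
        rw [← h]
        simpa using hne
      rwa [hE', termExponent, Finsupp.add_apply, Finsupp.single_apply, if_neg h', zero_add]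
    · rwa [hE, termExponent, Finsupp.add_apply, Finsupp.single_apply, if_neg h, zero_add]
  obtain ⟨w, rfl⟩ := exists_add_of_le hle
  have e : ∀ l, termExponent U k l + w - rowMonomial (dropColumn U l) =
      w + Finsupp.single (toLex (k, U l)) 1 := by
    intro l
    rw [termExponent, add_right_comm, add_tsub_cancel_right, add_comm w]
  have e₁ := e k.succ
  have e₂ := e k.castSucc
  rw [← hE] at e₁
  rw [← hE'] at e₂
  have hX : ∀ l, monomial (w + Finsupp.single (toLex (k, U l)) 1) (1 : K) =
      monomial w 1 * X (toLex (k, U l)) := by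
    intro l
    rw [X, monomial_mul, mul_one]
  set T : Fin (d + 2) → PolyRing K (d + 1) n := fun l =>
    X (toLex (k, U l)) * columnDet K (dropColumn U l) with hT
  have hsum : T k.succ - T k.castSucc = (-1) ^ (k : ℕ) *
      ∑ l ∈ (Finset.univ.erase k.castSucc).erase k.succ, (-1) ^ (l : ℕ) * T l := by
    have h := sum_X_mul_columnDet_dropColumn K U k
    simp_rw [mul_assoc] at h
    change ∑ l : Fin (d + 2), (-1) ^ (l : ℕ) * T l = 0 at h
    rw [← Finset.add_sum_erase _ _ (Finset.mem_univ k.castSucc),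
      ← Finset.add_sum_erase _ _ (Finset.mem_erase.2
        ⟨(Fin.castSucc_lt_succ_iff.2 (le_refl k)).ne', Finset.mem_univ k.succ⟩)] at h
    rw [Fin.val_castSucc, Fin.val_succ, pow_succ] at h
    have hs : ((-1 : PolyRing K (d + 1) n) ^ (k : ℕ)) * (-1) ^ (k : ℕ) = 1 := by
      rw [← mul_pow]
      simp
    linear_combination (-(-1 : PolyRing K (d + 1) n) ^ (k : ℕ)) * h +
      (T k.castSucc - T k.succ) * hs
  rw [SyzygyLifts, degree_minorFamily, degree_minorFamily, e₁, e₂, hX, hX, mul_assoc, mul_assoc,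
    ← mul_sub]
  change monomial w 1 * (T k.succ - T k.castSucc) ∈ _
  rw [hsum, mul_left_comm, Finset.mul_sum, Finset.mul_sum]
  refine Submodule.sum_mem _ fun l hl => ?_
  obtain ⟨hl₂, hl₁⟩ := Finset.mem_erase.1 hl
  have hterm : (-1) ^ (k : ℕ) * (monomial w 1 * ((-1) ^ (l : ℕ) * T l)) =
      monomial (w + Finsupp.single (toLex (k, U l)) 1) ((-1 : K) ^ (k + l : ℕ)) *
        minorFamily K 𝓕 ⟨dropColumn U l, hU l⟩ := by
    have hc : monomial (w + Finsupp.single (toLex (k, U l)) 1) ((-1 : K) ^ (k + l : ℕ)) =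
        (-1) ^ (k + l : ℕ) * (monomial w 1 * X (toLex (k, U l))) := by
      rw [← hX, ← map_one C, ← map_neg, ← map_pow, C_mul_monomial, mul_one]
    rw [hc, hT, minorFamily]
    ring
  rw [hterm]
  refine monomial_mul_mem_multiples _ ?_
  rw [degree_minorFamily, Set.mem_Iio, add_assoc, add_comm E, map_add _ w, map_add _ w]
  gcongr
  exact termExponent_lt U k (Finset.mem_erase.1 hl₁).1 hl₂

/-- Two members of an exchange-closed family that differ in exactly one position. -/
lemma IsExchangeClosed.syzygyLifts_of_eq_off (h𝓕 : IsExchangeClosed 𝓕) {i j : 𝓕}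
    {k : Fin (d + 1)} (hk : i.1 k ≠ j.1 k) (heq : ∀ r ≠ k, i.1 r = j.1 r)
    {u : Fin (d + 1) ×ₗ Fin n →₀ ℕ} (hi : rowMonomial i.1 ≤ u) (hj : rowMonomial j.1 ≤ u) :
    SyzygyLifts (lexOrder (d + 1) n) (minorFamily K 𝓕) u i j := by
  obtain ⟨i, hi'⟩ := i
  obtain ⟨j, hj'⟩ := j
  rcases lt_or_gt_of_ne hk with h | h
  · obtain ⟨U, rfl, rfl⟩ := exists_dropColumn_eq h heq
    exact syzygyLifts_dropColumn k (h𝓕.dropColumn_mem U k hi' hj') hi hj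
  · obtain ⟨U, rfl, rfl⟩ := exists_dropColumn_eq h fun r hr => (heq r hr).symm
    exact (syzygyLifts_dropColumn k (h𝓕.dropColumn_mem U k hj' hi') hj hi).symm

/-- Members that share a position are joined by a path of members, consecutive ones differing in a
single position, whose leading monomials all divide the least common multiple of the two ends. -/
lemma IsExchangeClosed.syzygyLifts_of_apply_eq (h𝓕 : IsExchangeClosed 𝓕) {k₀ : Fin (d + 1)}
    {u : Fin (d + 1) ×ₗ Fin n →₀ ℕ} (N : ℕ) : ∀ i j : 𝓕, i.1 k₀ = j.1 k₀ →
      rowMonomial i.1 ≤ u → rowMonomial j.1 ≤ u →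
      (Finset.univ.filter fun k => i.1 k ≠ j.1 k).card = N →
      SyzygyLifts (lexOrder (d + 1) n) (minorFamily K 𝓕) u i j := by
  induction N using Nat.strong_induction_on with
  | _ N ih =>
  -- the step, in case the first set can be changed
  have step : ∀ i j : 𝓕, i.1 k₀ = j.1 k₀ → rowMonomial i.1 ≤ u → rowMonomial j.1 ≤ u →
      (Finset.univ.filter fun k => i.1 k ≠ j.1 k).card = N → ∀ k, i.1 k ≠ j.1 k →
      (StrictMono (Function.update i.1 k (j.1 k)) ∧ i.1 0 ≤ Function.update i.1 k (j.1 k) 0 ∧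
        Function.update i.1 k (j.1 k) (Fin.last d) ≤ i.1 (Fin.last d)) →
      SyzygyLifts (lexOrder (d + 1) n) (minorFamily K 𝓕) u i j := by
    rintro i j h₀ hi hj hN k hk ⟨hmono, hfirst, hlast⟩
    have hl : ∀ r, Function.update i.1 k (j.1 k) r = i.1 r ∨
        Function.update i.1 k (j.1 k) r = j.1 r := by
      intro r
      rcases eq_or_ne r k with rfl | hr
      · exact Or.inr (Function.update_self ..)
      · exact Or.inl (Function.update_of_ne hr ..)
    let l : 𝓕 := ⟨OrderEmbedding.ofStrictMono _ hmono,
      h𝓕.mem_of_forall_eq_or_eq i.1 i.2 j.1 j.2 ⟨k₀, h₀⟩ _ hl hfirst hlast⟩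
    have hlk : l.1 k = j.1 k := Function.update_self ..
    have hlr : ∀ r ≠ k, l.1 r = i.1 r := fun r hr => Function.update_of_ne hr ..
    have hlu : rowMonomial l.1 ≤ u := by
      rw [rowMonomial_le_iff] at hi hj ⊢
      intro r
      rcases eq_or_ne r k with rfl | hr
      · rw [hlk]
        exact hj r
      · rw [hlr r hr]
        exact hi r
    have hil : SyzygyLifts (lexOrder (d + 1) n) (minorFamily K 𝓕) u i l :=
      h𝓕.syzygyLifts_of_eq_off (hlk.symm ▸ hk) (fun r hr => (hlr r hr).symm) hi hlu
    refine hil.trans (ih _ ?_ l j ?_ hlu hj rfl)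
    · rw [← hN]
      refine Finset.card_lt_card ((Finset.ssubset_iff_of_subset fun r hr => ?_).2 ⟨k, ?_, ?_⟩)
      · have hr' : l.1 r ≠ j.1 r := by simpa using hr
        have : r ≠ k := by
          rintro rfl
          exact hr' hlk
        rw [hlr r this] at hr'
        simpa using hr'
      · simpa using hk
      · simpa using hlk
    · rw [hlr k₀ (by rintro rfl; exact hk h₀), h₀]
  intro i j h₀ hi hj hN
  by_cases hij : i = j
  · exact hij ▸ SyzygyLifts.refl u i
  obtain ⟨k, hk, h | h⟩ := exists_strictMono_update (fun h => hij (Subtype.ext h)) h₀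
  · exact step i j h₀ hi hj hN k hk h
  · refine (step j i h₀.symm hj hi ?_ k hk.symm h).symm
    simpa [ne_comm] using hN

/-- The minors of an exchange-closed family form a reduced Gröbner basis. -/
theorem IsExchangeClosed.isReducedGroebnerBasis (h𝓕 : IsExchangeClosed 𝓕) :
    IsReducedGroebnerBasis (lexOrder (d + 1) n)
      ((fun i : Fin (d + 1) ↪o Fin n => columnDet K i) '' 𝓕)
      (Ideal.span ((fun i : Fin (d + 1) ↪o Fin n => columnDet K i) '' 𝓕)) := by
  have : Finite (Fin (d + 1) ↪o Fin n) := DFunLike.finite _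
  have hmonic : ∀ i : 𝓕, (lexOrder (d + 1) n).Monic (minorFamily K 𝓕 i) :=
    fun i => monic_columnDet i.1.strictMono
  refine IsGroebnerBasis.isReduced (isGroebnerBasis_span (Set.toFinite _) ?_ ?_)
  · rintro _ ⟨i, -, rfl⟩
    exact monic_columnDet i.strictMono
  intro p hp hp0
  rw [← range_minorFamily] at hp
  suffices H : ∀ u i j, _ → _ → SyzygyLifts (lexOrder (d + 1) n) (minorFamily K 𝓕) u i j by
    obtain ⟨i, hi⟩ := exists_degree_le_of_syzygyLifts hmonic H hp hp0
    exact ⟨_, ⟨i.1, i.2, rfl⟩, hi⟩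
  intro u i j hi hj
  by_cases hk : ∃ k₀, i.1 k₀ = j.1 k₀
  · obtain ⟨k₀, h₀⟩ := hk
    rw [degree_minorFamily] at hi hj
    exact h𝓕.syzygyLifts_of_apply_eq _ i j h₀ hi hj rfl
  · refine SyzygyLifts.of_disjoint hmonic hi hj ?_
    rintro ⟨k, c⟩
    rw [degree_minorFamily, degree_minorFamily]
    change rowMonomial i.1 (toLex (k, c)) = 0 ∨ rowMonomial j.1 (toLex (k, c)) = 0
    rw [rowMonomial_apply, rowMonomial_apply]
    by_cases h : i.1 k = c
    · refine Or.inr (if_neg fun h' => hk ⟨k, h.trans h'.symm⟩)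
    · exact Or.inl (if_neg h)

end Lifting

/-! ### Minors in a Gröbner basis that share a position -/

section Truncate

variable {σ K : Type*} [Field K]

open Classical in
/-- The endomorphism of the polynomial ring that sets the variables outside `s` to zero. -/
def truncate (s : Set σ) : MvPolynomial σ K →ₐ[K] MvPolynomial σ K :=
  aeval fun v => if v ∈ s then X v else 0

lemma truncate_X_of_notMem {s : Set σ} {v : σ} (hv : v ∉ s) :
    truncate s (X v : MvPolynomial σ K) = 0 := by
  rw [truncate, aeval_X, if_neg hv]

lemma coeff_truncate {s : Set σ} {t : σ →₀ ℕ} (ht : ∀ v ∈ t.support, v ∈ s)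
    (p : MvPolynomial σ K) : coeff t (truncate s p) = coeff t p := by
  classical
  induction p using MvPolynomial.induction_on' with
  | add p q hp hq => rw [map_add, coeff_add, coeff_add, hp, hq]
  | monomial u a =>
    by_cases hu : ∀ v ∈ u.support, v ∈ s
    · have : truncate s (monomial u a) = monomial u a := by
        rw [truncate, aeval_monomial, monomial_eq, Finsupp.prod, Finsupp.prod]
        exact congrArg (C a * ·) (Finset.prod_congr rfl fun v hv => by rw [if_pos (hu v hv)])
      rw [this]
    · have hne : u ≠ t := by
        rintro rfl
        exact hu ht
      push Not at hu
      obtain ⟨v, hv, hvs⟩ := hu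
      have : truncate s (monomial u a) = 0 := by
        rw [truncate, aeval_monomial, Finsupp.prod, Finset.prod_eq_zero hv, mul_zero]
        rw [if_neg hvs, zero_pow (Finsupp.mem_support_iff.1 hv)]
      rw [this, coeff_monomial, if_neg hne, coeff_zero]

end Truncate

section Necessity

variable {m n : ℕ} {K : Type*} [Field K] {𝓕 : Set (Fin m ↪o Fin n)}

/-- The variables in the columns of `i` or `j`. -/
def columnVars (i j : Fin m ↪o Fin n) : Set (Fin m ×ₗ Fin n) :=
  {v | (∃ l, (ofLex v).2 = i l) ∨ ∃ l, (ofLex v).2 = j l}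

lemma columnDet_mem_supported {i : Fin m → Fin n} {s : Set (Fin m ×ₗ Fin n)}
    (h : ∀ k l, toLex (k, i l) ∈ s) : columnDet K i ∈ supported K s := by
  rw [columnDet, Matrix.det_apply]
  refine Subalgebra.sum_mem _ fun p _ => ?_
  rw [Units.smul_def]
  exact Subalgebra.zsmul_mem _ (Subalgebra.prod_mem _ fun k _ => X_mem_supported.2 (h _ _)) _

lemma monomial_mem_supported {σ : Type*} {s : Set σ} {t : σ →₀ ℕ} (h : ∀ v ∈ t.support, v ∈ s)
    (c : K) : monomial t c ∈ supported K s := by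
  rw [mem_supported]
  by_cases hc : c = 0
  · simp [hc]
  · rw [vars_monomial hc]
    exact h

/-- If a Gröbner basis of maximal minors has only the members `i` and `j` on the columns of `i` and
`j`, then division of an element of the ideal that involves only these columns uses only
`i` and `j`. -/
lemma IsGroebnerBasis.exists_eq_mul_add_mul [NeZero m]
    (hB : IsGroebnerBasis (lexOrder m n) ((fun i : Fin m ↪o Fin n => columnDet K i) '' 𝓕)
      (Ideal.span ((fun i : Fin m ↪o Fin n => columnDet K i) '' 𝓕)))
    {i j : Fin m ↪o Fin n} (hi : i ∈ 𝓕) (hj : j ∈ 𝓕)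
    (hij : ∀ h ∈ 𝓕, (∀ k, (∃ l, h k = i l) ∨ ∃ l, h k = j l) → h = i ∨ h = j)
    {p : PolyRing K m n} (hp : p ∈ Ideal.span ((fun i : Fin m ↪o Fin n => columnDet K i) '' 𝓕))
    (hps : p ∈ supported K (columnVars i j)) :
    ∃ P Q : PolyRing K m n, p = P * columnDet K i + Q * columnDet K j ∧
      (∀ t ∈ P.support, t + rowMonomial i ≼[lexOrder m n] (lexOrder m n).degree p) ∧
      ∀ t ∈ Q.support, t + rowMonomial j ≼[lexOrder m n] (lexOrder m n).degree p := by
  classical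
  induction hu : (lexOrder m n).toSyn ((lexOrder m n).degree p) using WellFoundedLT.induction
    generalizing p with
  | ind u ih =>
  subst hu
  by_cases hp0 : p = 0
  · exact ⟨0, 0, by simp [hp0], by simp, by simp⟩
  obtain ⟨_, ⟨h, hh, rfl⟩, hle⟩ := hB.exists_degree_le
    (by rintro _ ⟨i, -, rfl⟩; exact monic_columnDet i.strictMono) hp hp0
  have hmon : (lexOrder m n).Monic (columnDet K h) := monic_columnDet h.strictMono
  have hunit : IsUnit ((lexOrder m n).leadingCoeff (columnDet K h)) := by
    rw [hmon.leadingCoeff_eq_one]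
    exact isUnit_one
  have hle' := hle
  rw [degree_columnDet h.strictMono] at hle'
  have hvar : ∀ v ∈ ((lexOrder m n).degree p).support, v ∈ columnVars i j := fun v hv =>
    (mem_supported.1 hps)
      ((mem_vars_iff_mem_support v).2 ⟨_, (lexOrder m n).degree_mem_support hp0, hv⟩)
  have hcol : ∀ k, (∃ l, h k = i l) ∨ ∃ l, h k = j l := fun k =>
    hvar (toLex (k, h k)) (Finsupp.mem_support_iff.2
      (Nat.one_le_iff_ne_zero.1 (rowMonomial_le_iff.1 hle' k)))
  have hdeg0 : (lexOrder m n).degree p ≠ 0 := by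
    intro h0
    rw [h0, rowMonomial_le_iff] at hle'
    exact absurd (hle' 0) (by simp)
  have hlt := MonomialOrder.degree_reduce_lt hunit hle hdeg0
  set r := (lexOrder m n).degree p - (lexOrder m n).degree (columnDet K h) with hr
  obtain ⟨c, hc⟩ : ∃ c, (lexOrder m n).reduce hunit p = p - monomial r c * columnDet K h :=
    ⟨_, rfl⟩
  rw [hc] at hlt
  have hmem : columnDet K h ∈ supported K (columnVars i j) :=
    columnDet_mem_supported fun k l => hcol l
  obtain ⟨P, Q, hPQ, hP, hQ⟩ := ih _ hlt
    (sub_mem hp (Ideal.mul_mem_left _ _ (Ideal.subset_span ⟨h, hh, rfl⟩)))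
    (sub_mem hps (mul_mem (monomial_mem_supported (fun v hv => hvar v
      (Finsupp.support_mono tsub_le_self hv)) c) hmem)) rfl
  have hrle : r + rowMonomial h = (lexOrder m n).degree p := by
    rw [hr, degree_columnDet h.strictMono, tsub_add_cancel_of_le hle']
  have hsupp : ∀ t ∈ (monomial r c).support,
      t + rowMonomial h ≼[lexOrder m n] (lexOrder m n).degree p := by
    intro t ht
    rw [Finset.mem_singleton.1 (support_monomial_subset ht), hrle]
  rcases hij h hh hcol with rfl | rfl
  · refine ⟨P + monomial r c, Q, ?_, fun t ht => ?_, fun t ht => (hQ t ht).trans hlt.le⟩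
    · linear_combination hPQ
    · rcases Finset.mem_union.1 (support_add ht) with ht | ht
      exacts [(hP t ht).trans hlt.le, hsupp t ht]
  · refine ⟨P, Q + monomial r c, ?_, fun t ht => (hP t ht).trans hlt.le, fun t ht => ?_⟩
    · linear_combination hPQ
    · rcases Finset.mem_union.1 (support_add ht) with ht | ht
      exacts [(hQ t ht).trans hlt.le, hsupp t ht]

/-- If two minors in a Gröbner basis of maximal minors share a position, the Gröbner basis contains
a third minor on their columns. Otherwise reducing their S-polynomial would give a relation
`A * det i = B * det j` in which `B` contains the monomial `x ^ (deg i - deg j)`, free of the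
variables of the shared row `k₀`. Keeping in row `k₀` only the variable of a column of `j` that is
not in `i` makes `det i` vanish, but neither `B` nor `det j`. -/
theorem IsGroebnerBasis.exists_mem_ne
    (hB : IsGroebnerBasis (lexOrder m n) ((fun i : Fin m ↪o Fin n => columnDet K i) '' 𝓕)
      (Ideal.span ((fun i : Fin m ↪o Fin n => columnDet K i) '' 𝓕)))
    {i j : Fin m ↪o Fin n} (hi : i ∈ 𝓕) (hj : j ∈ 𝓕) (hne : i ≠ j) {k₀ : Fin m}
    (hk₀ : i k₀ = j k₀) :
    ∃ h ∈ 𝓕, (∀ k, (∃ l, h k = i l) ∨ ∃ l, h k = j l) ∧ h ≠ i ∧ h ≠ j := by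
  classical
  by_contra! hcon
  have hij : ∀ h ∈ 𝓕, (∀ k, (∃ l, h k = i l) ∨ ∃ l, h k = j l) → h = i ∨ h = j := by
    intro h hh hcol
    by_cases hi : h = i
    · exact Or.inl hi
    · exact Or.inr (hcon h hh hcol hi)
  have : NeZero m := ⟨fun h => (h ▸ k₀).elim0⟩
  set a := rowMonomial j - rowMonomial i with ha
  set b := rowMonomial i - rowMonomial j with hb
  have hab : a + rowMonomial i = b + rowMonomial j := by
    ext v
    simp only [ha, hb, Finsupp.add_apply, Finsupp.tsub_apply]
    omega
  have hdi : (lexOrder m n).degree (columnDet K i) = rowMonomial i := degree_columnDet i.strictMono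
  have hdj : (lexOrder m n).degree (columnDet K j) = rowMonomial j := degree_columnDet j.strictMono
  set S : PolyRing K m n := monomial a 1 * columnDet K i - monomial b 1 * columnDet K j with hS
  have hSlt : (lexOrder m n).degree S ≺[lexOrder m n] a + rowMonomial i := by
    rw [MonomialOrder.degree_lt_iff]
    · intro t ht
      have hS' : S = monomial a 1 * (columnDet K i - monomial (rowMonomial i) 1) -
          monomial b 1 * (columnDet K j - monomial (rowMonomial j) 1) := by
        rw [mul_sub, mul_sub, monomial_mul, monomial_mul, hab]
        ring
      rw [hS'] at ht
      rcases Finset.mem_union.1 (support_sub _ _ _ ht) with ht | ht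
      · rw [← hdi] at ht ⊢
        exact lt_of_mem_support_monomial_mul_sub (monic_columnDet i.strictMono) ht
      · rw [hab]
        rw [← hdj] at ht ⊢
        exact lt_of_mem_support_monomial_mul_sub (monic_columnDet j.strictMono) ht
    · rw [map_zero, MonomialOrder.toSyn_lt_iff_ne_zero, Ne, MonomialOrder.toSyn_eq_zero_iff]
      intro h0
      have := DFunLike.congr_fun h0 (toLex (k₀, i k₀))
      rw [Finsupp.add_apply, rowMonomial_apply, if_pos rfl] at this
      simp at this
  have hvar : ∀ h : Fin m ↪o Fin n, (∀ l, (∃ l', h l = i l') ∨ ∃ l', h l = j l') →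
      ∀ t ≤ rowMonomial h, ∀ v ∈ t.support, v ∈ columnVars i j := by
    rintro h hh t ht ⟨k, c⟩ hv
    have h1 : t (toLex (k, c)) ≠ 0 := Finsupp.mem_support_iff.1 hv
    have h2 := ht (toLex (k, c))
    rw [rowMonomial_apply] at h2
    have h3 : h k = c := by
      by_contra h3
      rw [if_neg h3] at h2
      omega
    exact h3 ▸ hh k
  have hci : ∀ l, (∃ l', i l = i l') ∨ ∃ l', i l = j l' := fun l => Or.inl ⟨l, rfl⟩
  have hcj : ∀ l, (∃ l', j l = i l') ∨ ∃ l', j l = j l' := fun l => Or.inr ⟨l, rfl⟩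
  have hSs : S ∈ supported K (columnVars i j) :=
    sub_mem (mul_mem (monomial_mem_supported (hvar j hcj a tsub_le_self) _)
        (columnDet_mem_supported fun _ l => hci l))
      (mul_mem (monomial_mem_supported (hvar i hci b tsub_le_self) _)
        (columnDet_mem_supported fun _ l => hcj l))
  have hSmem : S ∈ Ideal.span ((fun i : Fin m ↪o Fin n => columnDet K i) '' 𝓕) :=
    sub_mem (Ideal.mul_mem_left _ _ (Ideal.subset_span ⟨i, hi, rfl⟩))
      (Ideal.mul_mem_left _ _ (Ideal.subset_span ⟨j, hj, rfl⟩))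
  obtain ⟨P, Q, hPQ, -, hQ⟩ := hB.exists_eq_mul_add_mul hi hj hij hSmem hSs
  have hrel : (monomial a 1 - P) * columnDet K i = (monomial b 1 + Q) * columnDet K j := by
    linear_combination hPQ
  have hQb : coeff b Q = 0 := by
    by_contra h0
    have := (hQ b (mem_support_iff.2 h0)).trans_lt hSlt
    rw [hab] at this
    exact lt_irrefl _ this
  -- a column of `j` that is not a column of `i`
  obtain ⟨k₁, hk₁⟩ : ∃ k₁, ∀ l, j k₁ ≠ i l := by
    by_contra! h
    exact hne (orderEmbedding_eq_of_forall_exists_eq h).symm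
  set s : Set (Fin m ×ₗ Fin n) := {v | (ofLex v).1 ≠ k₀ ∨ (ofLex v).2 = j k₁} with hs
  have h1 : truncate s (columnDet K i) = 0 := by
    rw [columnDet, AlgHom.map_det]
    refine Matrix.det_eq_zero_of_row_eq_zero k₀ fun l => ?_
    refine truncate_X_of_notMem ?_
    rw [hs, Set.mem_ofPred_eq]
    push Not
    exact ⟨rfl, (hk₁ l).symm⟩
  have h2 : truncate s (columnDet K j) ≠ 0 := by
    intro h0
    have hc := coeff_rowMonomial_comp_perm_columnDet (K := K) j.injective (Equiv.swap k₀ k₁)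
    rw [← coeff_truncate (s := s), h0, coeff_zero] at hc
    · rcases Int.units_eq_one_or (Equiv.Perm.sign (Equiv.swap k₀ k₁)) with h | h <;>
        simp [h] at hc
    · rintro ⟨k, c⟩ hv
      have hv : rowMonomial (j ∘ Equiv.swap k₀ k₁) (toLex (k, c)) ≠ 0 :=
        Finsupp.mem_support_iff.1 hv
      rw [rowMonomial_apply] at hv
      have hkc : j (Equiv.swap k₀ k₁ k) = c := by
        by_contra h
        exact hv (if_neg h)
      by_cases hk : k = k₀
      · subst hk
        rw [Equiv.swap_apply_left] at hkc
        exact Or.inr hkc.symm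
      · exact Or.inl hk
  have h3 : truncate s (monomial b 1 + Q) ≠ 0 := by
    intro h0
    have hc : coeff b (monomial b 1 + Q) = 1 := by
      rw [coeff_add, coeff_monomial, if_pos rfl, hQb, add_zero]
    rw [← coeff_truncate (s := s), h0, coeff_zero] at hc
    · exact zero_ne_one hc
    · rintro ⟨k, c⟩ hv
      have hv : b (toLex (k, c)) ≠ 0 := Finsupp.mem_support_iff.1 hv
      left
      rintro rfl
      refine hv ?_
      rw [hb, Finsupp.tsub_apply, rowMonomial_apply, rowMonomial_apply]
      exact (congrArg (fun x => (if x = c then 1 else 0) - _) hk₀).trans (tsub_self _)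
  have := congrArg (truncate s) hrel
  rw [map_mul, map_mul, h1, mul_zero] at this
  exact mul_ne_zero h3 h2 this.symm

end Necessity

/-! ### Determinantal ideals, simplicial complexes and graphs -/

section Complexes

variable {d n : ℕ}

lemma isExchangeClosed_of_forall_mem (hd : 1 ≤ d) {𝓕 : Set (Fin (d + 1) ↪o Fin n)}
    (h : ∀ i ∈ 𝓕, ∀ j ∈ 𝓕, i ≠ j → (∃ k, i k = j k) → ∀ l : Fin (d + 1) ↪o Fin n,
      (∀ k, (∃ r, l k = i r) ∨ ∃ r, l k = j r) → l ∈ 𝓕) : IsExchangeClosed 𝓕 where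
  mem_of_forall_eq_or_eq i hi j hj hk l hl _ _ := by
    by_cases hij : i = j
    · subst hij
      rwa [show l = i from DFunLike.ext _ _ fun k => (hl k).elim id id]
    · exact h i hi j hj hij hk l fun k => (hl k).imp (fun h => ⟨k, h⟩) fun h => ⟨k, h⟩
  dropColumn_mem U k hi hj l := by
    have hlt : k.castSucc < k.succ := Fin.castSucc_lt_succ_iff.2 le_rfl
    have e₁ : dropColumn U k.succ k = U k.castSucc := by
      rw [dropColumn_apply, Fin.succAbove_of_castSucc_lt _ _ hlt]
    have e₂ : dropColumn U k.castSucc k = U k.succ := by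
      rw [dropColumn_apply, Fin.succAbove_of_le_castSucc _ _ le_rfl]
    refine h _ hi _ hj (fun heq => ?_) ?_ _ fun r => ?_
    · rw [heq, e₂] at e₁
      exact hlt.ne' (U.injective e₁)
    · -- as `1 ≤ d` there is a position other than `k`, and it is shared
      have : Nontrivial (Fin (d + 1)) := Fin.nontrivial_iff_two_le.2 (by omega)
      obtain ⟨r, hr⟩ := exists_ne k
      refine ⟨r, ?_⟩
      rw [dropColumn_apply, dropColumn_apply]
      rcases lt_or_gt_of_ne hr with hr | hr
      · rw [Fin.succAbove_of_castSucc_lt k.succ r (Fin.castSucc_lt_succ_iff.2 hr.le),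
          Fin.succAbove_of_castSucc_lt k.castSucc r (Fin.castSucc_lt_castSucc_iff.2 hr)]
      · rw [Fin.succAbove_of_le_castSucc k.succ r (Fin.succ_le_castSucc_iff.2 hr),
          Fin.succAbove_of_le_castSucc k.castSucc r (Fin.castSucc_le_castSucc_iff.2 hr.le)]
    · rw [dropColumn_apply]
      by_cases hr : l.succAbove r = k.succ
      · exact Or.inr ⟨k, by rw [hr, e₂]⟩
      · obtain ⟨r', hr'⟩ := Fin.exists_succAbove_eq hr
        exact Or.inl ⟨r', by rw [dropColumn_apply, hr']⟩

lemma mem_vertexSet {r : ℕ} {i : Fin r ↪o Fin n} {c : Fin n} :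
    c ∈ vertexSet i ↔ ∃ k, i k = c := by
  simp [vertexSet]

lemma card_vertexSet {r : ℕ} (i : Fin r ↪o Fin n) : (vertexSet i).card = r := by
  simp [vertexSet]

lemma vertexSet_injective {r : ℕ} : Function.Injective (vertexSet (n := n) (r := r)) := by
  intro i j h
  refine orderEmbedding_eq_of_forall_exists_eq fun k => ?_
  obtain ⟨l, hl⟩ := mem_vertexSet.1 (h ▸ mem_vertexSet.2 ⟨k, rfl⟩ : i k ∈ vertexSet j)
  exact ⟨l, hl.symm⟩

lemma vertexSet_subset_union_iff {r : ℕ} {i j l : Fin r ↪o Fin n} :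
    vertexSet l ⊆ vertexSet i ∪ vertexSet j ↔
      ∀ k, (∃ r, l k = i r) ∨ ∃ r, l k = j r := by
  simp only [Finset.subset_iff, Finset.mem_union, mem_vertexSet, eq_comm (a := l _)]
  constructor
  · exact fun h k => h ⟨k, rfl⟩
  · rintro h _ ⟨k, rfl⟩
    exact h k

lemma IsPureOfDim.mem_facets {V : Type*} [Finite V] {Δ : PreAbstractSimplicialComplex V}
    (hΔ : IsPureOfDim Δ d) {H : Finset V} (hH : H ∈ Δ.faces) (hcard : H.card = d + 1) :
    H ∈ facets Δ := by
  obtain ⟨M, hHM, hM⟩ := (Set.toFinite Δ.faces).exists_le_maximal hH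
  have hMf : M ∈ facets Δ := ⟨hM.prop, fun N hN h => hM.eq_of_le hN h⟩
  rwa [Finset.eq_of_subset_of_card_le hHM (by rw [hcard, hΔ.2 M hMf])]

/-- The facets of a complex, as increasing sequences of vertices. -/
def facetFamily (Δ : PreAbstractSimplicialComplex (Fin n)) (d : ℕ) :
    Set (Fin (d + 1) ↪o Fin n) :=
  {i | vertexSet i ∈ facets Δ}

lemma facetMinors_eq_image (K : Type*) [Field K] (Δ : PreAbstractSimplicialComplex (Fin n))
    (d : ℕ) : facetMinors K Δ d =
      (fun i : Fin (d + 1) ↪o Fin n => columnDet K i) '' facetFamily Δ d := by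
  ext p
  simp only [facetMinors, facetFamily, Set.mem_image]
  exact exists_congr fun i => and_congr_right fun _ => eq_comm

lemma minors_genericMatrix_eq_image (K : Type*) [Field K] (m n : ℕ) :
    minors (genericMatrix K m n) m =
      (fun i : Fin m ↪o Fin n => columnDet K i) '' Set.univ := by
  rw [Set.image_univ]
  ext p
  constructor
  · rintro ⟨i, j, rfl⟩
    have : i = RelEmbedding.refl _ := orderEmbedding_eq_of_forall_exists_eq fun k => ⟨i k, rfl⟩
    rw [this]
    exact ⟨j, rfl⟩
  · rintro ⟨j, rfl⟩
    exact ⟨RelEmbedding.refl _, j, rfl⟩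

lemma IsClosedComplex.isExchangeClosed (hd : 1 ≤ d) {Δ : PreAbstractSimplicialComplex (Fin n)}
    (hΔ : IsPureOfDim Δ d) (h : IsClosedComplex Δ d) : IsExchangeClosed (facetFamily Δ d) := by
  refine isExchangeClosed_of_forall_mem hd fun i hi j hj hij hk l hl => ?_
  refine hΔ.mem_facets (h i j hi hj hij hk _ (vertexSet_subset_union_iff.2 hl) ?_ ?_)
    (card_vertexSet l)
  · exact ⟨l 0, mem_vertexSet.2 ⟨0, rfl⟩⟩
  · exact (card_vertexSet l).le

lemma IsUnitIntervalComplex.isExchangeClosed (hd : 1 ≤ d)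
    {Δ : PreAbstractSimplicialComplex (Fin n)} (h : IsUnitIntervalComplex Δ d) :
    IsExchangeClosed (facetFamily Δ d) where
  mem_of_forall_eq_or_eq i hi _ _ _ l _ h₀ h₁ := h i l hi h₀ h₁
  dropColumn_mem U k hi hj l := by
    -- one of the two given sets contains both ends of `U`
    have ends : ∀ x : Fin (d + 2), x ≠ 0 → x ≠ Fin.last (d + 1) →
        dropColumn U x ∈ facetFamily Δ d → dropColumn U l ∈ facetFamily Δ d := by
      intro x hx₀ hx₁ hx
      refine h _ _ hx ?_ ?_
      · rw [dropColumn_apply, dropColumn_apply, Fin.succAbove_ne_zero_zero hx₀]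
        exact U.monotone (Fin.zero_le _)
      · rw [dropColumn_apply, dropColumn_apply, Fin.succAbove_ne_last_last hx₁]
        exact U.monotone (Fin.le_last _)
    rcases eq_or_ne k 0 with rfl | hk
    · refine ends _ (Fin.succ_ne_zero _) (fun h => ?_) hi
      have := congrArg Fin.val h
      simp at this
      omega
    · exact ends _ (by simpa using hk) (Fin.castSucc_lt_last k).ne hj

end Complexes

section Graphs

variable {n : ℕ}

/-- The edges of a graph on `[n]`, as increasing sequences of vertices. The length is written
`1 + 1` to match `IsExchangeClosed` for `d = 1`. -/
def edgeFamily (G : SimpleGraph (Fin n)) : Set (Fin (1 + 1) ↪o Fin n) :=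
  {i | G.Adj (i 0) (i 1)}

/-- The sequence `a < b`. -/
def pairEmbedding {a b : Fin n} (h : a < b) : Fin (1 + 1) ↪o Fin n :=
  OrderEmbedding.ofStrictMono ![a, b] (by
    rw [Fin.strictMono_iff_lt_succ]
    intro i
    fin_cases i
    exact h)

lemma edgeMinors_eq_image (K : Type*) [Field K] (G : SimpleGraph (Fin n)) :
    edgeMinors K G = (fun i : Fin (1 + 1) ↪o Fin n => columnDet K i) '' edgeFamily G := by
  ext p
  constructor
  · rintro ⟨a, b, hab, hG, rfl⟩
    exact ⟨pairEmbedding hab, hG, rfl⟩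
  · rintro ⟨i, hi, rfl⟩
    refine ⟨i 0, i 1, i.strictMono Fin.zero_lt_one, hi, congrArg (columnDet K) ?_⟩
    funext k
    fin_cases k <;> rfl

lemma IsClosedGraph.isExchangeClosed {G : SimpleGraph (Fin n)} (hG : IsClosedGraph G) :
    IsExchangeClosed (edgeFamily G) where
  mem_of_forall_eq_or_eq i hi j hj hk l hl _ _ := by
    have hlij : l = i ∨ l = j := by
      have ext : ∀ x : Fin (1 + 1) ↪o Fin n, l 0 = x 0 → l 1 = x 1 → l = x :=
        fun x h₀ h₁ => DFunLike.ext _ _ (Fin.forall_fin_two.2 ⟨h₀, h₁⟩)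
      obtain ⟨k, hk⟩ := hk
      have hk' : i 0 = j 0 ∨ i 1 = j 1 := by
        fin_cases k
        exacts [Or.inl hk, Or.inr hk]
      rcases hl 0 with h0 | h0 <;> rcases hl 1 with h1 | h1
      · exact Or.inl (ext i h0 h1)
      · rcases hk' with h | h
        exacts [Or.inr (ext j (h0.trans h) h1), Or.inl (ext i h0 (h1.trans h.symm))]
      · rcases hk' with h | h
        exacts [Or.inl (ext i (h0.trans h.symm) h1), Or.inr (ext j h0 (h1.trans h))]
      · exact Or.inr (ext j h0 h1)
    rcases hlij with rfl | rfl
    exacts [hi, hj]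
  dropColumn_mem U k hi hj := by
    have h01 : U 0 < U 1 := U.strictMono (by decide)
    have h12 : U 1 < U 2 := U.strictMono (by decide)
    suffices H : G.Adj (U 1) (U 2) ∧ G.Adj (U 0) (U 2) ∧ G.Adj (U 0) (U 1) by
      intro l
      fin_cases l
      exacts [H.1, H.2.1, H.2.2]
    fin_cases k
    · have h02 : G.Adj (U 0) (U 2) := hi
      have h12' : G.Adj (U 1) (U 2) := hj
      exact ⟨h12', h02, hG.2 _ _ _ h01 h12 h02 h12'⟩
    · have h01' : G.Adj (U 0) (U 1) := hi
      have h02 : G.Adj (U 0) (U 2) := hj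
      exact ⟨hG.1 _ _ _ h01 h12 h01' h02, h02, h01'⟩

lemma isClosedGraph_of_isGroebnerBasis {K : Type*} [Field K] {G : SimpleGraph (Fin n)}
    (h : IsGroebnerBasis (lexOrder 2 n) (edgeMinors K G) (binomialEdgeIdeal K G)) :
    IsClosedGraph G := by
  rw [binomialEdgeIdeal, edgeMinors_eq_image] at h
  -- the third edge on the vertices of two edges that share a position
  have key : ∀ i j : Fin (1 + 1) ↪o Fin n, i ∈ edgeFamily G → j ∈ edgeFamily G → i ≠ j →
      (∃ k, i k = j k) → ∃ a b, a < b ∧ G.Adj a b ∧ (a = i 0 ∨ a = i 1 ∨ a = j 0 ∨ a = j 1) ∧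
        (b = i 0 ∨ b = i 1 ∨ b = j 0 ∨ b = j 1) ∧ ¬ (a = i 0 ∧ b = i 1) ∧
        ¬ (a = j 0 ∧ b = j 1) := by
    rintro i j hi hj hij ⟨k, hk⟩
    obtain ⟨l, hl, hcol, hli, hlj⟩ := h.exists_mem_ne hi hj hij hk
    refine ⟨l 0, l 1, l.strictMono Fin.zero_lt_one, hl, ?_, ?_, ?_, ?_⟩
    · simpa [Fin.exists_fin_two, or_assoc] using hcol 0
    · simpa [Fin.exists_fin_two, or_assoc] using hcol 1
    · exact fun h => hli (DFunLike.ext _ _ (Fin.forall_fin_two.2 h))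
    · exact fun h => hlj (DFunLike.ext _ _ (Fin.forall_fin_two.2 h))
  constructor
  · intro i j k hij hjk hGij hGik
    obtain ⟨a, b, hab, hG, ha, hb, h₁, h₂⟩ := key (pairEmbedding hij)
      (pairEmbedding (hij.trans hjk)) hGij hGik (fun h => hjk.ne (DFunLike.congr_fun h 1)) ⟨0, rfl⟩
    change a = i ∨ a = j ∨ a = i ∨ a = k at ha
    change b = i ∨ b = j ∨ b = i ∨ b = k at hb
    change ¬ (a = i ∧ b = j) at h₁
    change ¬ (a = i ∧ b = k) at h₂
    grind
  · intro i k j hik hkj hGij hGkj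
    obtain ⟨a, b, hab, hG, ha, hb, h₁, h₂⟩ := key (pairEmbedding (hik.trans hkj))
      (pairEmbedding hkj) hGij hGkj (fun h => hik.ne (DFunLike.congr_fun h 0)) ⟨1, rfl⟩
    change a = i ∨ a = j ∨ a = k ∨ a = j at ha
    change b = i ∨ b = j ∨ b = k ∨ b = j at hb
    change ¬ (a = i ∧ b = j) at h₁
    change ¬ (a = k ∧ b = j) at h₂
    grind

end Graphs

end DetFacet

end

theorem theorem2p2 (K : Type*) [Field K] (d n : ℕ) (hd : 1 ≤ d) :
    -- the maximal minors of the generic matrix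
    DetFacet.IsReducedGroebnerBasis (DetFacet.lexOrder (d + 1) n)
        (DetFacet.minors (DetFacet.genericMatrix K (d + 1) n) (d + 1))
        (DetFacet.determinantalIdeal (DetFacet.genericMatrix K (d + 1) n) (d + 1)) ∧
    (∀ Δ : PreAbstractSimplicialComplex (Fin n), DetFacet.IsPureOfDim Δ d →
      -- closed complexes
      (DetFacet.IsClosedComplex Δ d →
        DetFacet.IsReducedGroebnerBasis (DetFacet.lexOrder (d + 1) n)
          (DetFacet.facetMinors K Δ d) (DetFacet.facetIdeal K Δ d)) ∧
      -- unit interval complexes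
      (DetFacet.IsUnitIntervalComplex Δ d →
        DetFacet.IsReducedGroebnerBasis (DetFacet.lexOrder (d + 1) n)
          (DetFacet.facetMinors K Δ d) (DetFacet.facetIdeal K Δ d)) ∧
      -- the necessary condition
      (DetFacet.IsGroebnerBasis (DetFacet.lexOrder (d + 1) n)
          (DetFacet.facetMinors K Δ d) (DetFacet.facetIdeal K Δ d) →
        DetFacet.IsPoorClosedComplex Δ d)) ∧
    -- binomial edge ideals
    (∀ G : SimpleGraph (Fin n),
      DetFacet.IsClosedGraph G ↔
        DetFacet.IsReducedGroebnerBasis (DetFacet.lexOrder 2 n)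
          (DetFacet.edgeMinors K G) (DetFacet.binomialEdgeIdeal K G)) := by
  refine ⟨?_, fun Δ hΔ => ⟨fun h => ?_, fun h => ?_, fun h => ?_⟩, fun G => ⟨fun h => ?_, fun h =>
    DetFacet.isClosedGraph_of_isGroebnerBasis h.1⟩⟩
  · rw [DetFacet.determinantalIdeal, DetFacet.minors_genericMatrix_eq_image]
    exact (DetFacet.isExchangeClosed_of_forall_mem hd
      fun _ _ _ _ _ _ _ _ => Set.mem_univ _).isReducedGroebnerBasis
  · rw [DetFacet.facetIdeal, DetFacet.facetMinors_eq_image]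
    exact (h.isExchangeClosed hd hΔ).isReducedGroebnerBasis
  · rw [DetFacet.facetIdeal, DetFacet.facetMinors_eq_image]
    exact (h.isExchangeClosed hd).isReducedGroebnerBasis
  · rw [DetFacet.facetIdeal, DetFacet.facetMinors_eq_image] at h
    rintro i j hi hj hij ⟨k, hk⟩
    obtain ⟨l, hl, hcol, hli, hlj⟩ := h.exists_mem_ne hi hj hij hk
    exact ⟨_, hl, DetFacet.vertexSet_subset_union_iff.2 hcol,
      fun h => hli (DetFacet.vertexSet_injective h), fun h => hlj (DetFacet.vertexSet_injective h)⟩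
  · rw [DetFacet.binomialEdgeIdeal, DetFacet.edgeMinors_eq_image]
    exact h.isExchangeClosed.isReducedGroebnerBasis
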